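/- **Setting.** Let $N\ge 2$ and let $\Omega\subset\mathbb R^N$ be a bounded connected open set with Lipschitz boundary. Let $H^1_0(\Omega)$ be the closure of $C_0^\infty(\Omega)$ in $H^1(\Omega)$, and let $f\in H^{-1}(\Omega)=(H^1_0(\Omega))'$ and $y_d\in L^2(\Omega)$. For $A\in L^2(\Omega;\mathbb R^{N\times N})$ put $A^{sym}=\frac12(A+A^t)$ and $A^{skew}=\frac12(A-A^t)$. Let $D(A)$ be the set of $y\in H^1_0(\Omega)$ for which there is a constant $C$ with $$\Big|\int_\Omega(\nabla\varphi,A^{skew}\nabla y)\,dx\Big|\le C\|\nabla\varphi\|_{L^2(\Omega)}\qquad\forall\varphi\in C_0^\infty(\Omega).$$ For $y\in D(A)$ and $v\in H_0^1(\Omega)$ let $[y,v]_A=\lim\int_\Omega(\nabla\varphi,A^{skew}\nabla y)\,dx$ as $\varphi\to v$ in $H^1_0(\Omega)$, $\varphi\in C_0^\infty(\Omega)$. Let $0<\alpha\le\beta<\infty$ and $c>0$, let $A^*\ne0$ be a skew-symmetric matrix field in $L^2(\Omega;\mathbb R^{N\times N})$, and let $Q$ be a convex compact set of skew-symmetric matrix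 fields in $L^2(\Omega;\mathbb R^{N\times N})$ with $0\in Q$. The set $\mathfrak A_{ad}$ of admissible controls consists of all $A\in L^2(\Omega;\mathbb R^{N\times N})$ such that - the entries of $A^{sym}$ satisfy $TV(a^{sym}_{ij})\le c$, where $TV$ is the total variation in $\Omega$, and $\alpha I\le A^{sym}(x)\le\beta I$ for a.e. $x\in\Omega$; - $|a^{skew}_{ij}|\le|a^*_{ij}|$ a.e. in $\Omega$ for all $i<j$, and $A^{skew}\in Q$. A weak solution for a control $A$ is a $y\in H^1_0(\Omega)$ with $\int_\Omega(\nabla\varphi,A\nabla y)\,dx=\langle f,\varphi\rangle$ for all $\varphi\in C_0^\infty(\Omega)$. An admissible pair is a pair $(A,y)$ with $A\in\mathfrak A_{ad}$ and $y\in D(A)$ a weak solution for $A$. An optimal pair is an admissible pair that minimizes $$I(A,y)=\|y-y_d\|_{L^2(\Omega)}^2+\int_\Omega(\nabla y,A^{sym}\nabla y)\,dx$$ among all admissible pairs. **Hypotheses.** Let $A_0\in L^2(\Omega;\mathbb R^{N\times N})$ and $y_0\in H^1_0(\Omega)$, and write $A_\theta=A_0+\theta(\widehat A-A_0)$ for $\widehat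 A\in\mathfrak A_{ad}$ and $\theta\in[0,1]$. Fix $\lambda_0>0$ (its value is immaterial, since quasi-adjoint states scale linearly with it). Assume: - (H1) $D(A)\supseteq D(A^*)$ for every $A\in\mathfrak A_{ad}$. - (H2) $(A_0,y_0)$ is an optimal pair and $y_0\in D(A^*)$. - (H3) For every $\widehat A\in\mathfrak A_{ad}$ and $\theta\in[0,1]$ there is given a weak solution $y(A_\theta)$ for the control $A_\theta$ such that, for each $\widehat A$, $y(A_\theta)\rightharpoonup y_0$ weakly in $H^1_0(\Omega)$ as $\theta\to0^+$ and $y(A_\theta)\in D(A^*)$ for all sufficiently small $\theta>0$. - (H4) For every $\widehat A\in\mathfrak A_{ad}$ and every choice of numbers $\varepsilon_\theta\in[0,1]$ there are quasi-adjoint states $\psi_\theta$, $\theta\in[0,1]$, that is, elements of $H^1_0(\Omega)$ with $$\int_\Omega(\nabla\varphi,A_\theta^t\nabla\psi_\theta)\,dx=-2\lambda_0\int_\Omega(y_\theta-y_d)\varphi\,dx-2\lambda_0\int_\Omega(\nabla\varphi,A_\theta^{sym}\nabla y_\theta)\,dx\quad\forall\varphi\in C_0^\infty(\Omega),$$ where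 $y_\theta=y_0+\varepsilon_\theta(y(A_\theta)-y_0)$, with the following two properties. First, for each $\theta\in[0,1]$ there is $\gamma\in(0,\infty]$ such that either $\nabla\psi_\theta\in L^\infty$, or both $A^*\in L^{2+4/\gamma}$ and $\nabla\psi_\theta\in L^{2+\gamma}$. Second, $\{\psi_\theta\}$ is relatively compact in the strong topology of $H^1_0(\Omega)$ as $\theta\to0$: for every sequence $\theta_k\in(0,1]$ with $\theta_k\to0$, $(\psi_{\theta_k})$ has a strongly convergent subsequence. **Theorem.** There exist $\lambda\ge0$ and $\overline\psi\in H^1_0(\Omega)$, not both zero, such that $$\int_\Omega(\nabla\varphi,A_0\nabla y_0)\,dx=\langle f,\varphi\rangle\qquad\forall\varphi\in C_0^\infty(\Omega),$$ $$\int_\Omega(\nabla\varphi,A_0^t\nabla\overline\psi)\,dx=-2\lambda\int_\Omega(y_0-y_d)\varphi\,dx-2\lambda\int_\Omega(\nabla\varphi,A_0^{sym}\nabla y_0)\,dx\qquad\forall\varphi\in C_0^\infty(\Omega),$$ $$\int_\Omega\big(\nabla y_0,(A^{sym}-A_0^{sym})(\lambda\nabla y_0+\nabla\overline\psi)\big)\,dx\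 \ge\ [y_0,\overline\psi]_{A_0}-[y_0,\overline\psi]_A\qquad\forall A\in\mathfrak A_{ad}.$$ -/

import Mathlib

open MeasureTheory Filter Topology TopologicalSpace Matrix
open scoped ENNReal NNReal ContDiff Distributions RealInnerProductSpace

noncomputable section

namespace SkewControl

/-- The space `ℝ^N` with its Euclidean norm. -/
abbrev E (N : ℕ) := EuclideanSpace ℝ (Fin N)

/-- Lebesgue measure on `Ω`. -/
abbrev vol {N : ℕ} (Ω : Opens (E N)) : Measure (E N) := volume.restrict (Ω : Set (E N))

/-- `L²(Ω)`. -/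
abbrev L2 {N : ℕ} (Ω : Opens (E N)) := Lp ℝ 2 (vol Ω)

/-- `L²(Ω; ℝ^N)`. -/
abbrev L2Vec {N : ℕ} (Ω : Opens (E N)) := Lp (E N) 2 (vol Ω)

/-- `L²(Ω; 𝕄^N)`, as `N × N` matrices of elements of `L²(Ω)`; its topology is the product
topology, which is the topology of the `L²`-norm. -/
abbrev L2Mat {N : ℕ} (Ω : Opens (E N)) := Matrix (Fin N) (Fin N) (L2 Ω)

/-- `Ω` has Lipschitz boundary: near every boundary point `x₀`, and for a suitable unit vector `e`,
`Ω` is the set of points strictly above the graph (in direction `e`) of a Lipschitz function `g` on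
the hyperplane orthogonal to `e`. Only the values of `g` on that hyperplane matter. -/
def HasLipschitzBoundary {N : ℕ} (Ω : Opens (E N)) : Prop :=
  ∀ x₀ ∈ frontier (Ω : Set (E N)), ∃ r > (0 : ℝ), ∃ e : E N, ‖e‖ = 1 ∧
    ∃ (g : E N → ℝ) (K : ℝ≥0), LipschitzWith K g ∧
      ∀ x ∈ Metric.ball x₀ r, x ∈ Ω ↔ g (x - ⟪e, x⟫ • e) < ⟪e, x⟫

/-! ### The space `H¹₀(Ω)` -/

section H10

variable {N : ℕ} {Ω : Opens (E N)}

lemma contDiff_gradient (φ : 𝓓(Ω, ℝ)) : ContDiff ℝ ∞ (gradient φ) := by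
  have h : ContDiff ℝ ∞ (fderiv ℝ φ) := φ.contDiff.fderiv_right (by exact le_rfl)
  exact (InnerProductSpace.toDual ℝ (E N)).symm.contDiff.comp h

lemma hasCompactSupport_gradient (φ : 𝓓(Ω, ℝ)) : HasCompactSupport (gradient φ) :=
  (φ.hasCompactSupport.fderiv (𝕜 := ℝ)).comp_left (map_zero _)

lemma memLp_test (φ : 𝓓(Ω, ℝ)) (p : ℝ≥0∞) : MemLp φ p (vol Ω) :=
  (φ.continuous.memLp_of_hasCompactSupport φ.hasCompactSupport).restrict _

lemma memLp_gradient (φ : 𝓓(Ω, ℝ)) (p : ℝ≥0∞) : MemLp (gradient φ) p (vol Ω) :=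
  ((contDiff_gradient φ).continuous.memLp_of_hasCompactSupport
    (hasCompactSupport_gradient φ)).restrict _

/-- The map `φ ↦ (φ, ∇φ)` from `C₀^∞(Ω)` to `L²(Ω) × L²(Ω; ℝ^N)`, the latter with the Hilbert
norm `(‖u‖² + ‖g‖²)^{1/2}`, so that this is the embedding of `C₀^∞(Ω)` into `H¹(Ω)`. -/
def testToPair (Ω : Opens (E N)) : 𝓓(Ω, ℝ) →ₗ[ℝ] WithLp 2 (L2 Ω × L2Vec Ω) where
  toFun φ := WithLp.toLp 2 ((memLp_test φ 2).toLp φ, (memLp_gradient φ 2).toLp (gradient φ))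
  map_add' φ ψ := by
    have h : gradient (φ + ψ : 𝓓(Ω, ℝ)) = gradient φ + gradient ψ := by
      funext x
      have := fderiv_add (𝕜 := ℝ) (x := x) (φ.contDiff.differentiable (by simp) x)
        (ψ.contDiff.differentiable (by simp) x)
      simp only [gradient, Pi.add_apply, ← map_add]
      rw [← this]
      rfl
    rw [← WithLp.toLp_add]
    congr 1
    refine Prod.ext ?_ ?_
    · exact (memLp_test φ 2).toLp_add (memLp_test ψ 2)
    · simp only [Prod.snd_add, ← MemLp.toLp_add]
      exact MemLp.toLp_congr _ _ (by rw [h])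
  map_smul' c φ := by
    have h : gradient (c • φ : 𝓓(Ω, ℝ)) = c • gradient φ := by
      funext x
      have := fderiv_const_smul (𝕜 := ℝ) (x := x) (φ.contDiff.differentiable (by simp) x) c
      simp only [gradient, Pi.smul_apply, ← map_smul]
      rw [← this]
      rfl
    rw [RingHom.id_apply, ← WithLp.toLp_smul]
    congr 1
    refine Prod.ext ?_ ?_
    · exact (memLp_test φ 2).toLp_const_smul c
    · simp only [Prod.smul_snd, ← MemLp.toLp_const_smul]
      exact MemLp.toLp_congr _ _ (by rw [h])

variable (Ω) in
/-- `H¹₀(Ω)`: the closure of `C₀^∞(Ω)` in `H¹(Ω)`. An element is stored as the pair `(u, ∇u)` of the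
function and its weak gradient. (On a bounded `Ω` the inherited `H¹`-norm is equivalent to
`‖∇u‖_{L²}`.) -/
abbrev H10 : Submodule ℝ (WithLp 2 (L2 Ω × L2Vec Ω)) :=
  (LinearMap.range (testToPair Ω)).topologicalClosure

/-- The function underlying an element of `H¹₀(Ω)`. -/
def val (v : H10 Ω) : L2 Ω := v.1.fst

/-- The (weak) gradient of an element of `H¹₀(Ω)`. -/
def grad (v : H10 Ω) : L2Vec Ω := v.1.snd

/-- The inclusion `C₀^∞(Ω) ⊆ H¹₀(Ω)`. -/
def ofTest (φ : 𝓓(Ω, ℝ)) : H10 Ω :=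
  ⟨testToPair Ω φ, Submodule.le_topologicalClosure _ (LinearMap.mem_range_self _ φ)⟩

end H10

/-! ### Matrix fields -/

section Matrices

variable {N : ℕ} {Ω : Opens (E N)}

/-- `A(x) ξ` -/
def app (A : L2Mat Ω) (x : E N) (ξ : E N) : E N :=
  WithLp.toLp 2 ((A.map fun a => a x) *ᵥ ξ.ofLp)

/-- The symmetric part `A^{sym} = (A + Aᵗ)/2`. -/
def symPart (A : L2Mat Ω) : L2Mat Ω := (1 / 2 : ℝ) • (A + Aᵀ)

/-- The skew-symmetric part `A^{skew} = (A - Aᵗ)/2`. -/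
def skewPart (A : L2Mat Ω) : L2Mat Ω := (1 / 2 : ℝ) • (A - Aᵀ)

/-- `A` takes values in the skew-symmetric matrices. -/
def IsSkew (A : L2Mat Ω) : Prop := Aᵀ = -A

/-- `A ≼ B` for skew-symmetric fields: `|a_{ij}| ≤ |b_{ij}|` a.e. in `Ω` for `i < j`. -/
def Dominated (A B : L2Mat Ω) : Prop :=
  ∀ i j : Fin N, i < j → ∀ᵐ x ∂(vol Ω), |A i j x| ≤ |B i j x|

/-- The divergence of a vector field. -/
def divergence (φ : E N → E N) (x : E N) : ℝ :=
  ∑ i : Fin N, (fderiv ℝ φ x (EuclideanSpace.single i 1)) i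

/-- The total variation `sup { ∫_Ω a div φ dx : φ ∈ C₀¹(Ω; ℝ^N), |φ| ≤ 1 }` (the supremum is taken
over non-negative values because `φ` may be replaced by `-φ`). -/
def totalVariation (a : L2 Ω) : ℝ≥0∞ :=
  ⨆ φ : {φ : 𝓓^{1}(Ω, E N) // ∀ x, ‖φ x‖ ≤ 1},
    ENNReal.ofReal (∫ x in (Ω : Set (E N)), a x * divergence φ.1 x)

/-- `∫_Ω (∇φ, A^{skew} ∇y) dx` for a smooth `φ`. -/
def skewForm (A : L2Mat Ω) (y : H10 Ω) (φ : 𝓓(Ω, ℝ)) : ℝ :=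
  ∫ x in (Ω : Set (E N)), ⟪gradient φ x, app (skewPart A) x (grad y x)⟫

/-- The set `D(A) ⊆ H¹₀(Ω)`. -/
def D (A : L2Mat Ω) : Set (H10 Ω) :=
  {y | ∃ c : ℝ, ∀ φ : 𝓓(Ω, ℝ),
    |skewForm A y φ| ≤ c * Real.sqrt (∫ x in (Ω : Set (E N)), ‖gradient φ x‖ ^ 2)}

/-- The form `[y, v]_A` for `y ∈ D(A)` and `v ∈ H¹₀(Ω)`: the limit of `∫_Ω (∇φ, A^{skew} ∇y) dx` as
`φ → v` in `H¹₀(Ω)`, `φ ∈ C₀^∞(Ω)`. -/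
def bracket (A : L2Mat Ω) (y v : H10 Ω) : ℝ :=
  limUnder (comap ofTest (𝓝 v)) (skewForm A y)

end Matrices

/-! ### The optimal control problem -/

/-- The data of the control problem. -/
structure Data {N : ℕ} (Ω : Opens (E N)) where
  /-- lower ellipticity constant -/
  α : ℝ
  /-- upper ellipticity constant -/
  β : ℝ
  /-- bound for the total variation of the symmetric part -/
  c : ℝ
  /-- bound `A^*` for the skew-symmetric part -/
  Astar : L2Mat Ω
  /-- set of skew-symmetric parts -/
  Q : Set (L2Mat Ω)
  /-- right-hand side, in `H^{-1}(Ω)` -/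
  f : StrongDual ℝ (H10 Ω)
  /-- target -/
  yd : L2 Ω

/-- The standing assumptions on the data. -/
structure Data.Standing {N : ℕ} {Ω : Opens (E N)} (P : Data Ω) : Prop where
  α_pos : 0 < P.α
  α_le_β : P.α ≤ P.β
  c_pos : 0 < P.c
  Astar_skew : IsSkew P.Astar
  Astar_ne : P.Astar ≠ 0
  Q_skew : ∀ A ∈ P.Q, IsSkew A
  Q_convex : Convex ℝ P.Q
  Q_compact : IsCompact P.Q
  zero_mem_Q : (0 : L2Mat Ω) ∈ P.Q

namespace Data

variable {N : ℕ} {Ω : Opens (E N)} (P : Data Ω)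

/-- Admissible symmetric parts: `TV(a_{ij}) ≤ c` and `α I ≤ A(x) ≤ β I` a.e. in `Ω`. -/
def SymAdmissible (A : L2Mat Ω) : Prop :=
  (∀ i j, i ≤ j → totalVariation (A i j) ≤ ENNReal.ofReal P.c) ∧
  ∀ᵐ x ∂(vol Ω), ∀ ξ : E N,
    P.α * ‖ξ‖ ^ 2 ≤ ⟪app A x ξ, ξ⟫ ∧ ⟪app A x ξ, ξ⟫ ≤ P.β * ‖ξ‖ ^ 2

/-- The set `𝔄_ad` of admissible controls. -/
def Admissible : Set (L2Mat Ω) :=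
  {A | P.SymAdmissible (symPart A) ∧ Dominated (skewPart A) P.Astar ∧ skewPart A ∈ P.Q}

/-- `y ∈ H¹₀(Ω)` is a weak solution of `-div(A∇y) = f` in `Ω`, `y = 0` on `∂Ω`. -/
def IsWeakSolution (A : L2Mat Ω) (y : H10 Ω) : Prop :=
  ∀ φ : 𝓓(Ω, ℝ), ∫ x in (Ω : Set (E N)), ⟪gradient φ x, app A x (grad y x)⟫ = P.f (ofTest φ)

/-- The set `Ξ` of admissible pairs. -/
def AdmissiblePairs : Set (L2Mat Ω × H10 Ω) :=
  {p | p.1 ∈ P.Admissible ∧ p.2 ∈ D p.1 ∧ P.IsWeakSolution p.1 p.2}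

/-- The cost functional `I(A, y)`. -/
def cost (p : L2Mat Ω × H10 Ω) : ℝ :=
  ‖val p.2 - P.yd‖ ^ 2 +
    ∫ x in (Ω : Set (E N)), ⟪grad p.2 x, app (symPart p.1) x (grad p.2 x)⟫

/-- `(A, y)` is an optimal pair. -/
def IsOptimal (A : L2Mat Ω) (y : H10 Ω) : Prop :=
  (A, y) ∈ P.AdmissiblePairs ∧ IsMinOn P.cost P.AdmissiblePairs (A, y)

/-- `ψ` is a weak solution of `-div(Aᵗ∇ψ) = 2λ div(A^{sym}∇z) - 2λ(z - y_d)`, `ψ = 0` on `∂Ω`. -/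
def IsAdjointSolution (lam : ℝ) (A : L2Mat Ω) (z ψ : H10 Ω) : Prop :=
  ∀ φ : 𝓓(Ω, ℝ), ∫ x in (Ω : Set (E N)), ⟪gradient φ x, app Aᵀ x (grad ψ x)⟫ =
    -2 * lam * (∫ x in (Ω : Set (E N)), (val z x - P.yd x) * φ x)
    - 2 * lam * (∫ x in (Ω : Set (E N)), ⟪gradient φ x, app (symPart A) x (grad z x)⟫)

/-- `ψ` is the quasi-adjoint state to `y₀` for the control `A_θ`, the state `yθ = y(A_θ)` and the
value `ε ∈ [0, 1]`, with multiplier `λ`. -/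
def IsQuasiAdjoint (lam : ℝ) (Aθ : L2Mat Ω) (y₀ yθ : H10 Ω) (ε : ℝ) (ψ : H10 Ω) : Prop :=
  P.IsAdjointSolution lam Aθ (y₀ + ε • (yθ - y₀)) ψ

/-- `A_θ = A₀ + θ(Â - A₀)` -/
def segment (A₀ Ahat : L2Mat Ω) (θ : ℝ) : L2Mat Ω := A₀ + θ • (Ahat - A₀)

/-- Hypothesis (H1). -/
def H1 : Prop := ∀ A ∈ P.Admissible, D P.Astar ⊆ D A

/-- Hypothesis (H2), for the pair `(A₀, y₀)`. -/
def H2 (A₀ : L2Mat Ω) (y₀ : H10 Ω) : Prop := P.IsOptimal A₀ y₀ ∧ y₀ ∈ D P.Astar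

/-- Hypothesis (H3) for the pair `(A₀, y₀)`; `y Â θ` is the state chosen for the control
`A_θ = A₀ + θ(Â - A₀)`. Weak convergence in `H¹₀(Ω)` is tested with all of its dual. -/
def H3 (A₀ : L2Mat Ω) (y₀ : H10 Ω) (y : L2Mat Ω → ℝ → H10 Ω) : Prop :=
  ∀ Ahat ∈ P.Admissible,
    (∀ θ ∈ Set.Icc (0 : ℝ) 1, P.IsWeakSolution (segment A₀ Ahat θ) (y Ahat θ)) ∧
    (∀ ℓ : StrongDual ℝ (H10 Ω), Tendsto (fun θ => ℓ (y Ahat θ)) (𝓝[>] 0) (𝓝 (ℓ y₀))) ∧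
    ∀ᶠ θ in 𝓝[>] (0 : ℝ), y Ahat θ ∈ D P.Astar

/-- `∇ψ ∈ L^∞`, or `A^* ∈ L^{2+4/γ}` and `∇ψ ∈ L^{2+γ}` for some `γ ∈ (0, ∞]`. -/
def Regular (ψ : H10 Ω) : Prop :=
  ∃ γ : ℝ≥0∞, 0 < γ ∧
    (MemLp (grad ψ) ∞ (vol Ω) ∨
      ((∀ i j, MemLp (P.Astar i j) (2 + 4 / γ) (vol Ω)) ∧ MemLp (grad ψ) (2 + γ) (vol Ω)))

/-- Hypothesis (H4) for the pair `(A₀, y₀)`, the states `y Â θ` and the multiplier `λ`: for all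
choices `θ ↦ ε_θ ∈ [0, 1]` there are quasi-adjoint states `ψ_θ` with the required integrability
that are relatively compact in `H¹₀(Ω)` as `θ → 0`. -/
def H4 (A₀ : L2Mat Ω) (y₀ : H10 Ω) (y : L2Mat Ω → ℝ → H10 Ω) (lam : ℝ) : Prop :=
  ∀ Ahat ∈ P.Admissible, ∀ ε : ℝ → ℝ, (∀ θ, ε θ ∈ Set.Icc (0 : ℝ) 1) →
    ∃ ψ : ℝ → H10 Ω,
      (∀ θ ∈ Set.Icc (0 : ℝ) 1,
        P.IsQuasiAdjoint lam (segment A₀ Ahat θ) y₀ (y Ahat θ) (ε θ) (ψ θ) ∧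
        P.Regular (ψ θ)) ∧
      ∀ θ : ℕ → ℝ, (∀ k, θ k ∈ Set.Ioc (0 : ℝ) 1) → Tendsto θ atTop (𝓝 0) →
        ∃ (ψlim : H10 Ω) (σ : ℕ → ℕ), StrictMono σ ∧
          Tendsto (fun k => ψ (θ (σ k))) atTop (𝓝 ψlim)

end Data

end SkewControl

end

noncomputable section

namespace SkewControl

/-! The cost is quadratic in the state, so at the fixed control `A_θ` its increment from `y₀` to
`y(A_θ)` equals its derivative at the midpoint of the two states. With `ε_θ = 1/2`, the
quasi-adjoint equation for `ψ_θ`, tested with `y(A_θ) - y₀`, rewrites exactly this derivative, and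
the two state equations tested with `ψ_θ` eliminate `y(A_θ)`. What remains of optimality is exactly
`θ` times the desired inequality with `ψ_θ` in place of the limit adjoint state
(`optimality_inequality`, with its algebra in `nonneg_of_cost_le`).

A single adjoint state has to serve every `A`. It is therefore fixed beforehand as a regular adjoint
state `ψ₀` at `(A₀, y₀)`, and strong subsequential limits of `ψ_θ` along every segment are shown to
equal it (`quasiAdjoint_limit_eq`). In the energy of `ψ_θ - ψ₀` the skew part cancels; the remaining
terms either pair a strongly convergent sequence with a weakly null one or carry a factor `θ`.
Ellipticity and Poincaré's inequality then give equality. Since `y₀ ∈ D(A)`, the form `[y₀, ·]_A` is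
continuous on `H¹₀`, and the inequality passes to the limit. Nontriviality of the multipliers is
free, because `λ = λ₀ > 0`.

The delicate point is testing, because the skew part is unbounded. Regularity of `ψ` puts
`A^{skew}∇ψ` in `L²` by Hölder, so the adjoint equation may be tested with all of `H¹₀`. The state
equation tested with `ψ` gives `[y, ψ]_A`, a limit over test functions, which must be identified
with an integral (`bracket_eq_neg_integral`). This rests on `apply_eq_integral`: `ψ` is localised,
each piece is translated into the Lipschitz domain and mollified, and these last two operations do
not increase `L^q`-norms of gradients. Bounded images under `A^{skew}` together with `L²`
convergence of the gradients already give weak convergence of the images, so `q = ∞` is covered too.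
-/

set_option linter.unusedSectionVars false

/-! ### Averages of translates, mollification and segment averages in `L^q`. -/

section Averages

open scoped Convolution

/-- Minkowski's integral inequality for averages over a probability space. -/
lemma eLpNorm_integral_le {X Z F : Type*} [MeasurableSpace X] [MeasurableSpace Z]
    [NormedAddCommGroup F] [NormedSpace ℝ F] {ν : Measure X} {μ : Measure Z} [SFinite ν]
    [IsProbabilityMeasure μ] {q : ℝ≥0∞} (hq : 1 ≤ q) {f : X × Z → F}
    (hf : AEStronglyMeasurable f (ν.prod μ)) {C : ℝ≥0∞}
    (hC : ∀ᵐ z ∂μ, eLpNorm (fun x => f (x, z)) q ν ≤ C) :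
    eLpNorm (fun x => ∫ z, f (x, z) ∂μ) q ν ≤ C := by
  wlog hsm : StronglyMeasurable f generalizing f
  · have hxz : ∀ᵐ x ∂ν, ∀ᵐ z ∂μ, f (x, z) = hf.mk f (x, z) :=
      Measure.ae_ae_of_ae_prod hf.ae_eq_mk
    have hzx : ∀ᵐ z ∂μ, ∀ᵐ x ∂ν, f (x, z) = hf.mk f (x, z) := by
      refine Measure.ae_ae_of_ae_prod (p := fun w : Z × X => f (w.2, w.1) = hf.mk f (w.2, w.1)) ?_
      exact Measure.measurePreserving_swap.quasiMeasurePreserving.ae hf.ae_eq_mk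
    have := this (f := hf.mk f) hf.stronglyMeasurable_mk.aestronglyMeasurable
      (by filter_upwards [hC, hzx] with z h1 h2; rwa [← eLpNorm_congr_ae h2])
      hf.stronglyMeasurable_mk
    rwa [eLpNorm_congr_ae]
    filter_upwards [hxz] with x hx
    exact integral_congr_ae hx
  have hmeas : Measurable fun p : X × Z => ‖f p‖ₑ := hsm.enorm
  -- For `q = ∞` the bound is a statement about null sets, and Fubini exchanges the two "almost
  -- every" quantifiers. For finite `q`, Jensen's inequality on the probability space is followed by
  -- Tonelli.
  rcases eq_or_ne q ∞ with rfl | hq'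
  · have h1 : ∀ᵐ z ∂μ, ∀ᵐ x ∂ν, ‖f (x, z)‖ₑ ≤ C := by
      filter_upwards [hC] with z hz
      rw [eLpNorm_exponent_top] at hz
      filter_upwards [ae_le_eLpNormEssSup (f := fun x => f (x, z)) (μ := ν)] with x hx
      exact hx.trans hz
    have h2 : ∀ᵐ x ∂ν, ∀ᵐ z ∂μ, ‖f (x, z)‖ₑ ≤ C :=
      (Measure.ae_ae_comm (p := fun x z => ‖f (x, z)‖ₑ ≤ C)
        (measurableSet_le hmeas measurable_const)).2 h1
    rw [eLpNorm_exponent_top]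
    refine essSup_le_of_ae_le _ ?_
    filter_upwards [h2] with x hx
    calc ‖∫ z, f (x, z) ∂μ‖ₑ ≤ ∫⁻ z, ‖f (x, z)‖ₑ ∂μ := enorm_integral_le_lintegral_enorm _
      _ ≤ ∫⁻ _, C ∂μ := lintegral_mono_ae hx
      _ = C := by simp
  · have hq0 : q ≠ 0 := (zero_lt_one.trans_le hq).ne'
    have hqr : 0 < q.toReal := ENNReal.toReal_pos hq0 hq'
    rw [← ENNReal.rpow_le_rpow_iff hqr, eLpNorm_eq_lintegral_rpow_enorm_toReal hq0 hq',
      ← ENNReal.rpow_mul, one_div_mul_cancel hqr.ne', ENNReal.rpow_one]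
    calc ∫⁻ x, ‖∫ z, f (x, z) ∂μ‖ₑ ^ q.toReal ∂ν
        ≤ ∫⁻ x, ∫⁻ z, ‖f (x, z)‖ₑ ^ q.toReal ∂μ ∂ν := by
          refine lintegral_mono fun x => ?_
          have hx : AEStronglyMeasurable (fun z => f (x, z)) μ :=
            (hsm.comp_measurable measurable_prodMk_left).aestronglyMeasurable
          have h := eLpNorm_le_eLpNorm_of_exponent_le hq hx
          rw [eLpNorm_one_eq_lintegral_enorm, eLpNorm_eq_lintegral_rpow_enorm_toReal hq0 hq'] at h
          have h' := (enorm_integral_le_lintegral_enorm fun z => f (x, z)).trans h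
          rw [← ENNReal.rpow_le_rpow_iff hqr, ← ENNReal.rpow_mul, one_div_mul_cancel hqr.ne',
            ENNReal.rpow_one] at h'
          exact h'
      _ = ∫⁻ z, ∫⁻ x, ‖f (x, z)‖ₑ ^ q.toReal ∂ν ∂μ :=
          lintegral_lintegral_swap (hmeas.pow_const _).aemeasurable
      _ ≤ ∫⁻ _, C ^ q.toReal ∂μ := by
          refine lintegral_mono_ae ?_
          filter_upwards [hC] with z hz
          rw [eLpNorm_eq_lintegral_rpow_enorm_toReal hq0 hq', ← ENNReal.rpow_le_rpow_iff hqr,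
            ← ENNReal.rpow_mul, one_div_mul_cancel hqr.ne', ENNReal.rpow_one] at hz
          exact hz
      _ = C ^ q.toReal := by simp

variable {V : Type*} [NormedAddCommGroup V] [NormedSpace ℝ V] [FiniteDimensional ℝ V]
  [MeasurableSpace V] [BorelSpace V] {μ : Measure V} [μ.IsAddHaarMeasure]
  {F : Type*} [NormedAddCommGroup F] [NormedSpace ℝ F]

/-- Translations are continuous in `L^p`, `p < ∞`. -/
lemma exists_eLpNorm_translate_sub_le {p : ℝ≥0∞} (hp1 : 1 ≤ p) (hp : p ≠ ⊤) {u : V → F}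
    (hu : MemLp u p μ) {ε : ℝ≥0∞} (hε : ε ≠ 0) :
    ∃ δ > (0 : ℝ), ∀ z : V, ‖z‖ < δ → eLpNorm (fun x => u (x - z) - u x) p μ ≤ ε := by
  have : Fact (1 ≤ p) := ⟨hp1⟩
  let g : V → C(V, V) := fun z => ⟨fun x => x - z, by fun_prop⟩
  have hg : Continuous g := by
    refine ContinuousMap.continuous_of_continuous_uncurry _ ?_
    change Continuous fun q : V × V => q.2 - q.1
    fun_prop
  have hmp : ∀ z, MeasurePreserving (g z) μ μ := fun z => measurePreserving_sub_right μ z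
  have hc : Continuous fun z => Lp.compMeasurePreserving (g z) (hmp z) (hu.toLp u) :=
    continuous_const.compMeasurePreservingLp hg hmp hp
  have h0 := hc.tendsto 0
  rw [EMetric.tendsto_nhds] at h0
  obtain ⟨δ, hδ, h⟩ := Metric.eventually_nhds_iff.1 (h0 ε (pos_iff_ne_zero.2 hε))
  refine ⟨δ, hδ, fun z hz => ?_⟩
  have h1 := (h (by simpa using hz)).le
  rw [Lp.edist_def] at h1
  refine le_trans (eLpNorm_congr_ae ?_).le h1
  have e1 := Lp.coeFn_compMeasurePreserving (hu.toLp u) (hmp z)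
  have e2 := Lp.coeFn_compMeasurePreserving (hu.toLp u) (hmp 0)
  filter_upwards [e1, e2, (hmp z).quasiMeasurePreserving.ae hu.coeFn_toLp,
    (hmp 0).quasiMeasurePreserving.ae hu.coeFn_toLp] with x h1 h2 h3 h4
  simp only [Pi.sub_apply, h1, h2, Function.comp_apply, h3, h4]
  simp [g]

/-- A mollification kernel: a non-negative smooth function of compact support and integral `1`. -/
structure IsMollifier (μ : Measure V) (ρ : V → ℝ) : Prop where
  smooth : ContDiff ℝ ∞ ρ
  compact : HasCompactSupport ρ
  nonneg : ∀ x, 0 ≤ ρ x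
  integral : ∫ x, ρ x ∂μ = 1

/-- The probability measure with density `ρ`. -/
def densityMeasure (μ : Measure V) (ρ : V → ℝ) : Measure V :=
  μ.withDensity fun x => ENNReal.ofReal (ρ x)

namespace IsMollifier

variable {ρ : V → ℝ} (hρ : IsMollifier μ ρ)
include hρ

lemma isProbabilityMeasure : IsProbabilityMeasure (densityMeasure μ ρ) := by
  refine ⟨?_⟩
  rw [densityMeasure, withDensity_apply _ MeasurableSet.univ, setLIntegral_univ,
    ← ofReal_integral_eq_lintegral_ofReal
      (hρ.smooth.continuous.integrable_of_hasCompactSupport hρ.compact)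
      (Eventually.of_forall hρ.nonneg), hρ.integral, ENNReal.ofReal_one]

/-- Reading a mollification as an average of translates over a probability measure is what makes
Minkowski's inequality applicable, uniformly in `q`. -/
lemma convolution_eq (u : V → F) (x : V) :
    (ρ ⋆[ContinuousLinearMap.lsmul ℝ ℝ, μ] u) x = ∫ z, u (x - z) ∂(densityMeasure μ ρ) := by
  rw [densityMeasure, integral_withDensity_eq_integral_toReal_smul
    (hρ.smooth.continuous.measurable.ennreal_ofReal) (by simp), convolution_lsmul]
  simp only [ENNReal.toReal_ofReal (hρ.nonneg _)]

lemma aestronglyMeasurable_translate {u : V → F} (hu : AEStronglyMeasurable u μ) :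
    AEStronglyMeasurable (fun p : V × V => u (p.1 - p.2)) (μ.prod (densityMeasure μ ρ)) := by
  have h : AEStronglyMeasurable (fun p : V × V => u (p.1 - p.2)) (μ.prod μ) :=
    hu.comp_quasiMeasurePreserving (quasiMeasurePreserving_sub μ μ)
  exact h.mono_ac (Measure.AbsolutelyContinuous.rfl.prod (withDensity_absolutelyContinuous _ _))

/-- Mollification does not increase `L^q`-norms. -/
lemma eLpNorm_convolution_le {q : ℝ≥0∞} (hq : 1 ≤ q) {u : V → F}
    (hu : AEStronglyMeasurable u μ) :
    eLpNorm (ρ ⋆[ContinuousLinearMap.lsmul ℝ ℝ, μ] u) q μ ≤ eLpNorm u q μ := by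
  have := hρ.isProbabilityMeasure
  have := eLpNorm_integral_le hq (hρ.aestronglyMeasurable_translate hu)
    (C := eLpNorm u q μ) (Eventually.of_forall fun z =>
      (eLpNorm_comp_measurePreserving hu (measurePreserving_sub_right μ z)).le)
  refine le_trans (eLpNorm_congr_ae (Eventually.of_forall fun x => ?_)).le this
  exact hρ.convolution_eq u x

/-- Mollification with a kernel supported near `0` is close to the identity in `L^q`. -/
lemma eLpNorm_convolution_sub_le {q : ℝ≥0∞} (hq : 1 ≤ q) {u : V → F} [CompleteSpace F]
    (hu : MemLp u q μ) {δ : ℝ} {ε : ℝ≥0∞}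
    (hδ : ∀ z : V, ‖z‖ < δ → eLpNorm (fun x => u (x - z) - u x) q μ ≤ ε)
    (hs : ∀ z, ρ z ≠ 0 → ‖z‖ < δ) :
    eLpNorm (ρ ⋆[ContinuousLinearMap.lsmul ℝ ℝ, μ] u - u) q μ ≤ ε := by
  have := hρ.isProbabilityMeasure
  have hm : AEStronglyMeasurable (fun p : V × V => u (p.1 - p.2) - u p.1)
      (μ.prod (densityMeasure μ ρ)) :=
    (hρ.aestronglyMeasurable_translate hu.1).sub
      (hu.1.comp_quasiMeasurePreserving Measure.quasiMeasurePreserving_fst)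
  have hae : ∀ᵐ z ∂(densityMeasure μ ρ), ‖z‖ < δ := by
    rw [densityMeasure, ae_withDensity_iff (hρ.smooth.continuous.measurable.ennreal_ofReal)]
    refine Eventually.of_forall fun z hz => hs z fun h => hz ?_
    simp [h]
  have := eLpNorm_integral_le hq hm (C := ε) (hae.mono fun z hz => hδ z hz)
  refine le_trans (eLpNorm_congr_ae (Eventually.of_forall fun x => ?_)).le this
  have hint : Integrable (fun z => u (x - z)) (densityMeasure μ ρ) := by
    rw [densityMeasure, integrable_withDensity_iff_integrable_smul' 
      (hρ.smooth.continuous.measurable.ennreal_ofReal) (by simp)]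
    have hex : ConvolutionExistsAt ρ u x (ContinuousLinearMap.lsmul ℝ ℝ) μ :=
      hρ.compact.convolutionExists_left (ContinuousLinearMap.lsmul ℝ ℝ) hρ.smooth.continuous
        (hu.locallyIntegrable hq) x
    simpa only [ENNReal.toReal_ofReal (hρ.nonneg _)] using! hex.integrable
  rw [Pi.sub_apply, hρ.convolution_eq u x]
  exact ((integral_sub hint (integrable_const (u x))).trans (by simp)).symm

end IsMollifier

/-- There are mollification kernels with support in arbitrarily small balls. -/
lemma exists_isMollifier (c : V) {r : ℝ} (hr : 0 < r) :
    ∃ ρ : V → ℝ, IsMollifier μ ρ ∧ tsupport ρ = Metric.closedBall c r := by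
  let f : ContDiffBump c := ⟨r / 2, r, by positivity, by linarith⟩
  exact ⟨f.normed μ, ⟨f.contDiff_normed, f.hasCompactSupport_normed, f.nonneg_normed,
    f.integral_normed⟩, f.tsupport_normed_eq⟩

/-- Averages over segments do not increase `L^q`-norms. -/
lemma eLpNorm_segment_average_le {q : ℝ≥0∞} (hq : 1 ≤ q) (w : V) {u : V → F}
    (hu : AEStronglyMeasurable u μ) :
    eLpNorm (fun x => ∫ s in Set.Icc (0 : ℝ) 1, u (x + s • w)) q μ ≤ eLpNorm u q μ := by
  have : IsProbabilityMeasure (volume.restrict (Set.Icc (0 : ℝ) 1)) := ⟨by simp⟩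
  have hmp : ∀ s : ℝ, MeasurePreserving (fun x : V => x + s • w) μ μ := fun s =>
    measurePreserving_add_right μ _
  -- Each slice at fixed `s` is a translation, so the preimage of a null set has null slices and is
  -- null by Fubini.
  have hqmp : Measure.QuasiMeasurePreserving (fun p : V × ℝ => p.1 + p.2 • w)
      (μ.prod (volume.restrict (Set.Icc (0 : ℝ) 1))) μ := by
    refine ⟨by fun_prop, Measure.AbsolutelyContinuous.mk fun t ht h0 => ?_⟩
    have hm : Measurable fun p : V × ℝ => p.1 + p.2 • w := by fun_prop
    rw [Measure.map_apply hm ht, Measure.prod_apply_symm (hm ht)]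
    refine (lintegral_congr fun s => ?_).trans lintegral_zero
    exact ((hmp s).measure_preimage ht.nullMeasurableSet).trans h0
  refine eLpNorm_integral_le hq (f := fun p : V × ℝ => u (p.1 + p.2 • w))
    (hu.comp_quasiMeasurePreserving hqmp) (Eventually.of_forall fun s =>
      (eLpNorm_comp_measurePreserving hu (hmp s)).le)

end Averages

/-! ### Elements of `H¹₀(Ω)`, integration by parts and extension by zero. -/

section Sobolev

open scoped Convolution

variable {N : ℕ} {Ω : Opens (E N)}

lemma inner_gradient_eq_fderiv (f : E N → ℝ) (x w : E N) : ⟪gradient f x, w⟫ = fderiv ℝ f x w :=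
  InnerProductSpace.toDual_symm_apply

/-- The function underlying an element of `H¹₀(Ω)`, as a continuous linear map. -/
def valL (Ω : Opens (E N)) : H10 Ω →L[ℝ] L2 Ω :=
  (WithLp.fstL 2 ℝ (L2 Ω) (L2Vec Ω)).comp (H10 Ω).subtypeL

/-- The weak gradient, as a continuous linear map. -/
def gradL (Ω : Opens (E N)) : H10 Ω →L[ℝ] L2Vec Ω :=
  (WithLp.sndL 2 ℝ (L2 Ω) (L2Vec Ω)).comp (H10 Ω).subtypeL

@[simp] lemma valL_apply (v : H10 Ω) : valL Ω v = val v := rfl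
@[simp] lemma gradL_apply (v : H10 Ω) : gradL Ω v = grad v := rfl

/-- The inclusion of the test functions, as a linear map. -/
def ofTestL (Ω : Opens (E N)) : 𝓓(Ω, ℝ) →ₗ[ℝ] H10 Ω :=
  (testToPair Ω).codRestrict (H10 Ω) fun φ => (ofTest φ).2

@[simp] lemma ofTestL_apply (φ : 𝓓(Ω, ℝ)) : ofTestL Ω φ = ofTest φ := rfl


lemma val_ofTest_ae (φ : 𝓓(Ω, ℝ)) : val (ofTest φ) =ᵐ[vol Ω] φ := (memLp_test φ 2).coeFn_toLp
lemma grad_ofTest_ae (φ : 𝓓(Ω, ℝ)) : grad (ofTest φ) =ᵐ[vol Ω] gradient φ := (memLp_gradient φ 2).coeFn_toLp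

lemma exists_tendsto_ofTest (v : H10 Ω) :
    ∃ φ : ℕ → 𝓓(Ω, ℝ), Tendsto (fun k => ofTest (φ k)) atTop (𝓝 v) := by
  have hv : v.1 ∈ closure (LinearMap.range (testToPair Ω) : Set _) := v.2
  obtain ⟨u, hu, hlim⟩ := mem_closure_iff_seq_limit.1 hv
  choose φ hφ using hu
  refine ⟨φ, tendsto_subtype_rng.2 ?_⟩
  convert hlim using 2 with k
  exact hφ k

/-- The device behind every later change of test space: identities between functionals continuous on
`H¹₀(Ω)` need checking on test functions only. -/
lemma denseRange_ofTest : DenseRange (ofTest : 𝓓(Ω, ℝ) → H10 Ω) := fun v => by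
  obtain ⟨φ, hφ⟩ := exists_tendsto_ofTest v
  exact mem_closure_of_tendsto hφ (Eventually.of_forall fun k => ⟨φ k, rfl⟩)

lemma ext_val_grad {v w : H10 Ω} (h1 : val v = val w) (h2 : grad v = grad w) : v = w :=
  Subtype.ext ((WithLp.equiv 2 _).injective (Prod.ext h1 h2))

lemma memLp_val (v : H10 Ω) : MemLp (val v) 2 (vol Ω) := Lp.memLp _
lemma memLp_grad (v : H10 Ω) : MemLp (grad v) 2 (vol Ω) := Lp.memLp _

/-- Convergence in `H¹₀(Ω)` is convergence of the functions and of the gradients in `L²`. -/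
lemma tendsto_H10_iff {ι : Type*} {l : Filter ι} {u : ι → H10 Ω} {v : H10 Ω} :
    Tendsto u l (𝓝 v) ↔
      Tendsto (fun k => eLpNorm (val (u k) - val v : E N → ℝ) 2 (vol Ω)) l (𝓝 0) ∧
      Tendsto (fun k => eLpNorm (grad (u k) - grad v : E N → E N) 2 (vol Ω)) l (𝓝 0) := by
  rw [tendsto_subtype_rng, (WithLp.homeomorphProd 2 (L2 Ω) (L2Vec Ω)).isInducing.tendsto_nhds_iff,
    nhds_prod_eq, tendsto_prod_iff', ← Lp.tendsto_Lp_iff_tendsto_eLpNorm',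
    ← Lp.tendsto_Lp_iff_tendsto_eLpNorm']
  rfl

/-- The pair `(u, g)` is the pair of function and gradient of an element of `H¹₀(Ω)` if it is the
limit of such pairs. -/
lemma exists_H10_of_tendsto {u : E N → ℝ} {g : E N → E N} (hu : MemLp u 2 (vol Ω))
    (hg : MemLp g 2 (vol Ω)) (φ : ℕ → 𝓓(Ω, ℝ))
    (h1 : Tendsto (fun k => eLpNorm (⇑(φ k) - u) 2 (vol Ω)) atTop (𝓝 0))
    (h2 : Tendsto (fun k => eLpNorm (gradient (φ k) - g) 2 (vol Ω)) atTop (𝓝 0)) :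
    ∃ w : H10 Ω, val w =ᵐ[vol Ω] u ∧ grad w =ᵐ[vol Ω] g := by
  have t1 : Tendsto (fun k => (memLp_test (φ k) 2).toLp (φ k)) atTop (𝓝 (hu.toLp u)) :=
    (Lp.tendsto_Lp_iff_tendsto_eLpNorm'' _ (fun k => memLp_test (φ k) 2) _ hu).2 h1
  have t2 : Tendsto (fun k => (memLp_gradient (φ k) 2).toLp (gradient (φ k))) atTop
      (𝓝 (hg.toLp g)) :=
    (Lp.tendsto_Lp_iff_tendsto_eLpNorm'' _ (fun k => memLp_gradient (φ k) 2) _ hg).2 h2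
  have t : Tendsto (fun k => testToPair Ω (φ k)) atTop (𝓝 (WithLp.toLp 2 (hu.toLp u, hg.toLp g))) :=
    ((WithLp.prod_continuous_toLp 2 (L2 Ω) (L2Vec Ω)).tendsto _).comp (t1.prodMk_nhds t2)
  have hmem : WithLp.toLp 2 (hu.toLp u, hg.toLp g) ∈ H10 Ω :=
    mem_closure_of_tendsto t (Eventually.of_forall fun k => ⟨φ k, rfl⟩)
  exact ⟨⟨_, hmem⟩, hu.coeFn_toLp, hg.coeFn_toLp⟩

/-- The weak gradient is characterised by integration by parts. -/
lemma integral_val_mul_fderiv (v : H10 Ω) {ζ : E N → ℝ} (hζ : ContDiff ℝ ∞ ζ)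
    (hc : HasCompactSupport ζ) (w : E N) :
    ∫ x in (Ω : Set (E N)), val v x * fderiv ℝ ζ x w =
      -∫ x in (Ω : Set (E N)), ζ x * ⟪grad v x, w⟫ := by
  have hζ' : Continuous fun x => fderiv ℝ ζ x w :=
    (hζ.continuous_fderiv (by simp)).clm_apply continuous_const
  have hc' : HasCompactSupport fun x => fderiv ℝ ζ x w :=
    (hc.fderiv (𝕜 := ℝ)).comp_left (g := fun L : E N →L[ℝ] ℝ => L w) rfl
  have hm1 : MemLp (fun x => fderiv ℝ ζ x w) 2 (vol Ω) :=
    (hζ'.memLp_of_hasCompactSupport hc').restrict _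
  have hm2 : MemLp (fun x => ζ x • w) 2 (vol Ω) :=
    ((hζ.continuous.smul continuous_const).memLp_of_hasCompactSupport hc.smul_right).restrict _
  have e1 : ∀ v : H10 Ω, ∫ x in (Ω : Set (E N)), val v x * fderiv ℝ ζ x w =
      ⟪hm1.toLp _, valL Ω v⟫ := fun v => by
    rw [L2.inner_def]
    refine integral_congr_ae ?_
    filter_upwards [hm1.coeFn_toLp] with x hx
    simp [hx]
  have e2 : ∀ v : H10 Ω, ∫ x in (Ω : Set (E N)), ζ x * ⟪grad v x, w⟫ =
      ⟪hm2.toLp _, gradL Ω v⟫ := fun v => by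
    rw [L2.inner_def]
    refine integral_congr_ae ?_
    filter_upwards [hm2.coeFn_toLp] with x hx
    simp [hx, inner_smul_left, real_inner_comm]
  have key : (fun v : H10 Ω => ⟪hm1.toLp _, valL Ω v⟫) = fun v => -⟪hm2.toLp _, gradL Ω v⟫ := by
    refine denseRange_ofTest.equalizer (by fun_prop) (by fun_prop) (funext fun φ => ?_)
    simp only [Function.comp_apply]
    rw [← e1, ← e2]
    -- The support of `φ` lies in `Ω`, so both integrals extend to the whole space. No boundary term
    -- appears although `ζ` need not vanish on the boundary.
    have i1 : ∫ x in (Ω : Set (E N)), val (ofTest φ) x * fderiv ℝ ζ x w =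
        ∫ x, φ x * fderiv ℝ ζ x w := by
      rw [← setIntegral_eq_integral_of_forall_compl_eq_zero (s := (Ω : Set (E N)))
        (f := fun x => φ x * fderiv ℝ ζ x w)]
      · refine integral_congr_ae ?_
        filter_upwards [val_ofTest_ae φ] with x hx
        rw [hx]
      · intro x hx
        rw [image_eq_zero_of_notMem_tsupport fun h => hx (φ.tsupport_subset h), zero_mul]
    have i2 : ∫ x in (Ω : Set (E N)), ζ x * ⟪grad (ofTest φ) x, w⟫ =
        ∫ x, fderiv ℝ φ x w * ζ x := by
      rw [← setIntegral_eq_integral_of_forall_compl_eq_zero (s := (Ω : Set (E N)))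
        (f := fun x => fderiv ℝ φ x w * ζ x)]
      · refine integral_congr_ae ?_
        filter_upwards [grad_ofTest_ae φ] with x hx
        rw [hx, inner_gradient_eq_fderiv, mul_comm]
      · intro x hx
        rw [image_eq_zero_of_notMem_tsupport (f := fderiv ℝ φ)
          fun h => hx (φ.tsupport_subset (tsupport_fderiv_subset ℝ h))]
        simp
    rw [i1, i2]
    have cφ' : Continuous fun x => fderiv ℝ φ x w :=
      (φ.contDiff.continuous_fderiv (by simp)).clm_apply continuous_const
    refine integral_mul_fderiv_eq_neg_fderiv_mul_of_integrable ?_ ?_ ?_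
      (fun x _ => φ.contDiff.differentiable (by simp) x)
      (fun x _ => hζ.differentiable (by simp) x)
    · exact (cφ'.mul hζ.continuous).integrable_of_hasCompactSupport hc.mul_left
    · exact (φ.continuous.mul hζ').integrable_of_hasCompactSupport hc'.mul_left
    · exact (φ.continuous.mul hζ.continuous).integrable_of_hasCompactSupport hc.mul_left
  rw [e1, e2]
  exact congrFun key v

/-- Extension by zero of the function. -/
def extVal (v : H10 Ω) : E N → ℝ := (Ω : Set (E N)).indicator (val v)

/-- Extension by zero of the gradient. -/
def extGrad (v : H10 Ω) : E N → E N := (Ω : Set (E N)).indicator (grad v)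

lemma memLp_extVal (v : H10 Ω) {q : ℝ≥0∞} (h : MemLp (val v) q (vol Ω)) :
    MemLp (extVal v) q volume :=
  (memLp_indicator_iff_restrict Ω.isOpen.measurableSet).2 h

lemma memLp_extGrad (v : H10 Ω) {q : ℝ≥0∞} (h : MemLp (grad v) q (vol Ω)) :
    MemLp (extGrad v) q volume :=
  (memLp_indicator_iff_restrict Ω.isOpen.measurableSet).2 h

lemma eLpNorm_extVal (v : H10 Ω) (q : ℝ≥0∞) :
    eLpNorm (extVal v) q volume = eLpNorm (val v) q (vol Ω) :=
  eLpNorm_indicator_eq_eLpNorm_restrict Ω.isOpen.measurableSet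

lemma eLpNorm_extGrad (v : H10 Ω) (q : ℝ≥0∞) :
    eLpNorm (extGrad v) q volume = eLpNorm (grad v) q (vol Ω) :=
  eLpNorm_indicator_eq_eLpNorm_restrict Ω.isOpen.measurableSet

lemma extVal_ae (v : H10 Ω) : extVal v =ᵐ[vol Ω] val v :=
  indicator_ae_eq_restrict Ω.isOpen.measurableSet

lemma extGrad_ae (v : H10 Ω) : extGrad v =ᵐ[vol Ω] grad v :=
  indicator_ae_eq_restrict Ω.isOpen.measurableSet

/-- The mollification of an element of `H¹₀(Ω)`, extended by zero. -/
def mollify (ρ : E N → ℝ) (v : H10 Ω) : E N → ℝ :=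
  ρ ⋆[ContinuousLinearMap.lsmul ℝ ℝ, volume] extVal v

variable {ρ : E N → ℝ} (hρ : IsMollifier volume ρ)
include hρ

lemma contDiff_mollify (v : H10 Ω) : ContDiff ℝ ∞ (mollify ρ v) :=
  hρ.compact.contDiff_convolution_left _ hρ.smooth
    ((memLp_extVal v (memLp_val v)).locallyIntegrable (by norm_num))

/-- Mollification commutes with the gradient. -/
lemma gradient_mollify (v : H10 Ω) :
    gradient (mollify ρ v) = ρ ⋆[ContinuousLinearMap.lsmul ℝ ℝ, volume] extGrad v := by
  have lU : LocallyIntegrable (extVal v) volume :=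
    (memLp_extVal v (memLp_val v)).locallyIntegrable (by norm_num)
  have lG : LocallyIntegrable (extGrad v) volume :=
    (memLp_extGrad v (memLp_grad v)).locallyIntegrable (by norm_num)
  funext x
  refine ext_inner_right ℝ fun w => ?_
  have hd := hρ.compact.hasFDerivAt_convolution_left (ContinuousLinearMap.lsmul ℝ ℝ)
    (hρ.smooth.of_le (by simp)) lU x
  have hex : ConvolutionExistsAt (fderiv ℝ ρ) (extVal v) x
      ((ContinuousLinearMap.lsmul ℝ ℝ : ℝ →L[ℝ] ℝ →L[ℝ] ℝ).precompL (E N)) volume :=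
    (hρ.compact.fderiv (𝕜 := ℝ)).convolutionExists_left _
      (hρ.smooth.continuous_fderiv (by simp)) lU x
  have hexG : ConvolutionExistsAt ρ (extGrad v) x (ContinuousLinearMap.lsmul ℝ ℝ) volume :=
    hρ.compact.convolutionExists_left _ hρ.smooth.continuous lG x
  have hiG : Integrable fun z => ρ (x - z) • extGrad v z := hexG.integrable_swap
  have hζ : ContDiff ℝ ∞ fun z => ρ (x - z) := hρ.smooth.comp (contDiff_const.sub contDiff_id)
  have hcζ : HasCompactSupport fun z => ρ (x - z) :=
    hρ.compact.comp_homeomorph (Homeomorph.subLeft x)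
  have hdζ : ∀ z, fderiv ℝ (fun z => ρ (x - z)) z w = -fderiv ℝ ρ (x - z) w := fun z => by
    have h1 : HasFDerivAt ρ (fderiv ℝ ρ (x - z)) (x - z) :=
      (hρ.smooth.differentiable (by simp) _).hasFDerivAt
    have h2 := h1.comp z ((hasFDerivAt_id z).const_sub x)
    have h3 : fderiv ℝ (fun z => ρ (x - z)) z = _ := h2.fderiv
    rw [h3]
    simp
  -- The kernel `z ↦ ρ (x - z)` may reach across the boundary; this is harmless because the test
  -- function above is not required to be supported in `Ω`.
  have key := integral_val_mul_fderiv v hζ hcζ w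
  simp only [hdζ, mul_neg, integral_neg, neg_inj] at key
  rw [inner_gradient_eq_fderiv, mollify, hd.fderiv, convolution_eq_swap, convolution_lsmul_swap,
    ContinuousLinearMap.integral_apply hex.integrable_swap, real_inner_comm,
    ← innerSL_apply_apply ℝ, ← ContinuousLinearMap.integral_comp_comm _ hiG]
  have e1 : ∀ z, (((ContinuousLinearMap.lsmul ℝ ℝ : ℝ →L[ℝ] ℝ →L[ℝ] ℝ).precompL (E N)
      (fderiv ℝ ρ (x - z))) (extVal v z)) w =
      (Ω : Set (E N)).indicator (fun z => val v z * fderiv ℝ ρ (x - z) w) z := fun z => by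
    by_cases hz : z ∈ (Ω : Set (E N)) <;> simp [extVal, hz, mul_comm]
  have e2 : ∀ z, innerSL ℝ w (ρ (x - z) • extGrad v z) =
      (Ω : Set (E N)).indicator (fun z => ρ (x - z) * ⟪grad v z, w⟫) z := fun z => by
    by_cases hz : z ∈ (Ω : Set (E N)) <;>
      simp [extGrad, hz, real_inner_comm]
  simp only [e1, e2]
  rw [integral_indicator Ω.isOpen.measurableSet, integral_indicator Ω.isOpen.measurableSet, key]

end Sobolev

/-! ### Poincaré's inequality, approximation by translation, and cut-offs. -/

section Approximation

open scoped Convolution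

variable {N : ℕ} {Ω : Opens (E N)}

/-- Mollifications with kernels shrinking to the origin converge in `L^p`, `p < ∞`. -/
lemma tendsto_eLpNorm_convolution_sub {V F : Type*} [NormedAddCommGroup V] [NormedSpace ℝ V]
    [FiniteDimensional ℝ V] [MeasurableSpace V] [BorelSpace V] {μ : Measure V} [μ.IsAddHaarMeasure]
    [NormedAddCommGroup F] [NormedSpace ℝ F] [CompleteSpace F] {p : ℝ≥0∞} (hp1 : 1 ≤ p)
    (hp : p ≠ ⊤) {u : V → F} (hu : MemLp u p μ) {ρ : ℕ → V → ℝ} (hρ : ∀ k, IsMollifier μ (ρ k))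
    {δ : ℕ → ℝ} (hδ : Tendsto δ atTop (𝓝 0)) (hs : ∀ k z, ρ k z ≠ 0 → ‖z‖ ≤ δ k) :
    Tendsto (fun k => eLpNorm (ρ k ⋆[ContinuousLinearMap.lsmul ℝ ℝ, μ] u - u) p μ) atTop
      (𝓝 0) := by
  rw [ENNReal.tendsto_nhds_zero]
  intro ε hε
  obtain ⟨η, hη, h⟩ := exists_eLpNorm_translate_sub_le hp1 hp hu hε.ne'
  filter_upwards [hδ.eventually (gt_mem_nhds hη)] with k hk
  exact (hρ k).eLpNorm_convolution_sub_le hp1 hu h fun z hz => (hs k z hz).trans_lt hk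

/-- Localises the support of a mollification: it lies in the sum of a carrier `K` of the extended
function and the support of the kernel. The carrier need only be valid almost everywhere. -/
lemma exists_mem_of_mollify_ne_zero {ρ : E N → ℝ} {v : H10 Ω} {K : Set (E N)}
    (hK : ∀ᵐ z, z ∉ K → extVal v z = 0) {x : E N} (hx : mollify ρ v x ≠ 0) :
    ∃ z ∈ K, ρ (x - z) ≠ 0 := by
  by_contra! h
  refine hx ?_
  rw [mollify, convolution_lsmul_swap]
  refine integral_eq_zero_of_ae ?_
  filter_upwards [hK] with z hz
  by_cases hzK : z ∈ K
  · simp [h z hzK]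
  · simp [hz hzK]

/-- Poincaré's inequality in `L^q` for smooth functions supported in a ball. -/
lemma eLpNorm_le_eLpNorm_gradient {f : E N → ℝ} (hf : ContDiff ℝ ∞ f) {R : ℝ}
    (hR : ∀ x, f x ≠ 0 → ‖x‖ ≤ R) {w : E N} (hw : 2 * R < ‖w‖) {q : ℝ≥0∞} (hq : 1 ≤ q) :
    eLpNorm f q volume ≤ ENNReal.ofReal ‖w‖ * eLpNorm (gradient f) q volume := by
  have hg : Continuous (gradient f) :=
    (InnerProductSpace.toDual ℝ (E N)).symm.continuous.comp (hf.continuous_fderiv (by simp))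
  have hpt : ∀ x, ‖f x‖ ≤ ‖w‖ * ‖∫ s in Set.Icc (0 : ℝ) 1, gradient f (x + s • w)‖ := by
    intro x
    by_cases hx : f x = 0
    · rw [hx, norm_zero]; positivity
    -- A shift by more than the diameter leaves the ball, so `-f x` is the integral of the
    -- derivative along the segment from `x` to `x + w`.
    have hxw : f (x + w) = 0 := by
      by_contra h
      have h1 := hR _ h
      have h2 := hR _ hx
      have h3 : ‖w‖ ≤ ‖x + w‖ + ‖x‖ := by
        simpa using norm_sub_le (x + w) x
      linarith
    have hder : ∀ s : ℝ, HasDerivAt (fun s : ℝ => f (x + s • w)) ⟪w, gradient f (x + s • w)⟫ s := by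
      intro s
      have h1 : HasDerivAt (fun s : ℝ => x + s • w) w s := by
        simpa using ((hasDerivAt_id s).smul_const w).const_add x
      have h2 := (hf.differentiable (by simp) (x + s • w)).hasFDerivAt.comp_hasDerivAt s h1
      rwa [← inner_gradient_eq_fderiv, real_inner_comm] at h2
    have hcont : Continuous fun s : ℝ => gradient f (x + s • w) := by fun_prop
    have hftc := intervalIntegral.integral_eq_sub_of_hasDerivAt (a := 0) (b := 1)
      (fun s _ => hder s) ((by fun_prop : Continuous fun s : ℝ =>
        ⟪w, gradient f (x + s • w)⟫).intervalIntegrable 0 1)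
    rw [intervalIntegral.integral_of_le zero_le_one, ← integral_Icc_eq_integral_Ioc] at hftc
    simp only [one_smul, zero_smul, add_zero, hxw, zero_sub] at hftc
    have hint : Integrable (fun s : ℝ => gradient f (x + s • w))
        (volume.restrict (Set.Icc (0 : ℝ) 1)) := hcont.continuousOn.integrableOn_Icc
    have h3 := integral_inner (𝕜 := ℝ) hint w
    rw [hftc] at h3
    have h4 := norm_inner_le_norm (𝕜 := ℝ) w (∫ s in Set.Icc (0 : ℝ) 1, gradient f (x + s • w))
    rwa [← h3, norm_neg] at h4
  calc eLpNorm f q volume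
      ≤ ENNReal.ofReal ‖w‖ *
        eLpNorm (fun x => ∫ s in Set.Icc (0 : ℝ) 1, gradient f (x + s • w)) q volume :=
        eLpNorm_le_mul_eLpNorm_of_ae_le_mul (Eventually.of_forall hpt) q
    _ ≤ _ := by
        gcongr
        exact eLpNorm_segment_average_le hq w hg.aestronglyMeasurable

/-- Poincaré's inequality in `L^q` for elements of `H¹₀(Ω)`, `Ω` bounded. -/
lemma exists_eLpNorm_val_le (hN : 2 ≤ N) (hbdd : Bornology.IsBounded (Ω : Set (E N))) :
    ∃ C : ℝ, ∀ (v : H10 Ω) (q : ℝ≥0∞), 1 ≤ q →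
      eLpNorm (val v) q (vol Ω) ≤ ENNReal.ofReal C * eLpNorm (grad v) q (vol Ω) := by
  obtain ⟨R, hR⟩ := hbdd.exists_norm_le
  have : Nontrivial (E N) := by
    have : Nontrivial (Fin N) := Fin.nontrivial_iff_two_le.2 hN
    infer_instance
  -- The radius `R + 1` leaves room for kernels of radius at most `1`. The resulting constant `‖w‖`
  -- does not depend on `q`.
  obtain ⟨w, hw⟩ := NormedSpace.exists_lt_norm ℝ (E N) (2 * (R + 1))
  refine ⟨‖w‖, fun v q hq => ?_⟩
  have hk : ∀ k : ℕ, (0 : ℝ) < 1 / (k + 1) := fun k => by positivity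
  choose ρ hρ hsupp using fun k : ℕ => exists_isMollifier (μ := volume) (0 : E N) (hk k)
  have hsupp' : ∀ k z, ρ k z ≠ 0 → ‖z‖ ≤ 1 / ((k : ℝ) + 1) := fun k z hz => by
    have := subset_tsupport _ (Function.mem_support.2 hz)
    rw [hsupp k] at this
    simpa using this
  have h1 := tendsto_eLpNorm_convolution_sub (by norm_num) (by norm_num)
    (memLp_extVal v (memLp_val v)) hρ tendsto_one_div_add_atTop_nhds_zero_nat hsupp'
  have hmeas : ∀ k, AEStronglyMeasurable (mollify (ρ k) v) volume := fun k =>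
    (contDiff_mollify (hρ k) v).continuous.aestronglyMeasurable
  -- Convergence is only known in `L²`. Almost everywhere convergence of a subsequence and lower
  -- semicontinuity of the norm carry the bound to every `q`, including `∞`.
  obtain ⟨σ, -, hσ⟩ := (tendstoInMeasure_of_tendsto_eLpNorm two_ne_zero hmeas
    (memLp_extVal v (memLp_val v)).1 h1).exists_seq_tendsto_ae
  rw [← eLpNorm_extVal, ← eLpNorm_extGrad]
  refine (Lp.eLpNorm_lim_le_liminf_eLpNorm (fun k => hmeas (σ k)) _ hσ).trans ?_
  refine (liminf_le_liminf (v := fun _ => ENNReal.ofReal ‖w‖ * eLpNorm (extGrad v) q volume)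
    (Eventually.of_forall fun k => ?_)).trans (by simp)
  have hrad : ∀ x, mollify (ρ (σ k)) v x ≠ 0 → ‖x‖ ≤ R + 1 := by
    intro x hx
    obtain ⟨z, hz, hxz⟩ := exists_mem_of_mollify_ne_zero (K := (Ω : Set (E N)))
      (Eventually.of_forall fun z hz => Set.indicator_of_notMem hz _) hx
    have h2 := hsupp' _ _ hxz
    have h3 : (1 : ℝ) / ((σ k : ℝ) + 1) ≤ 1 := by
      rw [div_le_one (by positivity)]; linarith [(Nat.cast_nonneg (σ k) : (0 : ℝ) ≤ σ k)]
    have h4 := hR z hz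
    have h5 : ‖x‖ ≤ ‖x - z‖ + ‖z‖ := by simpa using norm_add_le (x - z) z
    linarith
  refine (eLpNorm_le_eLpNorm_gradient (contDiff_mollify (hρ _) v) hrad hw hq).trans ?_
  gcongr
  rw [gradient_mollify (hρ _)]
  exact (hρ _).eLpNorm_convolution_le hq (memLp_extGrad v (memLp_grad v)).1

lemma eq_zero_of_grad_eq_zero (hN : 2 ≤ N) (hbdd : Bornology.IsBounded (Ω : Set (E N)))
    {v : H10 Ω} (h : grad v = 0) : v = 0 := by
  obtain ⟨C, hC⟩ := exists_eLpNorm_val_le hN hbdd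
  refine ext_val_grad ?_ h
  have h1 := hC v 2 (by norm_num)
  rw [h, eLpNorm_congr_ae (Lp.coeFn_zero (E N) 2 (vol Ω)), eLpNorm_zero, mul_zero,
    nonpos_iff_eq_zero, eLpNorm_eq_zero_iff (memLp_val v).1 (by norm_num)] at h1
  exact Lp.ext (h1.trans (Lp.coeFn_zero _ _ _).symm)

/-- If a compact set `K` carrying `v ∈ H¹₀(Ω)` can be translated into `Ω` by arbitrarily small
multiples of a vector `e`, then `v` is a limit of test functions whose gradients are bounded by that
of `v` in all `L^q`. -/
lemma exists_approximation_of_translate {v : H10 Ω} {K : Set (E N)} (hK : IsCompact K)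
    (hv : ∀ᵐ z, z ∉ K → extVal v z = 0) {e : E N} {τ : ℝ} (hτ : 0 < τ)
    (he : ∀ x ∈ K, ∀ t : ℝ, 0 < t → t < τ → x + t • e ∈ Ω) :
    ∃ φ : ℕ → 𝓓(Ω, ℝ), Tendsto (fun k => ofTest (φ k)) atTop (𝓝 v) ∧
      ∀ k (q : ℝ≥0∞), 1 ≤ q →
        eLpNorm (gradient (φ k)) q (vol Ω) ≤ eLpNorm (grad v) q (vol Ω) := by
  let t : ℕ → ℝ := fun k => τ / 2 * (1 / ((k : ℝ) + 1))
  have hk : ∀ k : ℕ, (0 : ℝ) < 1 / (k + 1) := fun k => by positivity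
  have hk1 : ∀ k : ℕ, (1 : ℝ) / (k + 1) ≤ 1 := fun k => by
    rw [div_le_one (by positivity)]; linarith [(Nat.cast_nonneg k : (0 : ℝ) ≤ k)]
  have ht0 : ∀ k, 0 < t k := fun k => mul_pos (by positivity) (hk k)
  have ht1 : ∀ k, t k < τ := fun k => by
    have := mul_le_mul_of_nonneg_left (hk1 k) (by positivity : 0 ≤ τ / 2)
    simp only [t]; linarith
  have hKt : ∀ k, IsCompact ((fun x => x + t k • e) '' K) := fun k => hK.image (by fun_prop)
  have hsub : ∀ k, (fun x => x + t k • e) '' K ⊆ Ω := fun k => by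
    rintro _ ⟨x, hx, rfl⟩
    exact he x hx _ (ht0 k) (ht1 k)
  choose ε hε hεΩ using fun k => (hKt k).exists_cthickening_subset_open Ω.isOpen (hsub k)
  let r : ℕ → ℝ := fun k => min (ε k) (1 / ((k : ℝ) + 1))
  have hr : ∀ k, 0 < r k := fun k => lt_min (hε k) (hk k)
  -- Centring the kernel at `t k • e` rather than at the origin translates and smooths in a single
  -- convolution. The radius is at most `ε k`, which keeps the support in `Ω`, and shrinks with `k`.
  choose ρ hρ hsupp using fun k : ℕ => exists_isMollifier (μ := volume) (t k • e) (hr k)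
  have hmem : ∀ k z, ρ k z ≠ 0 → dist z (t k • e) ≤ r k := fun k z hz => by
    have := subset_tsupport _ (Function.mem_support.2 hz)
    rw [hsupp k] at this
    exact this
  have hs : ∀ k z, ρ k z ≠ 0 → ‖z‖ ≤ (τ / 2 * ‖e‖ + 1) * (1 / ((k : ℝ) + 1)) := fun k z hz => by
    have h1 := (hmem k z hz).trans (min_le_right _ _)
    have h2 : ‖z‖ ≤ dist z (t k • e) + ‖t k • e‖ := by
      rw [dist_eq_norm]; simpa using norm_add_le (z - t k • e) (t k • e)
    rw [norm_smul, Real.norm_of_nonneg (ht0 k).le] at h2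
    simp only [t] at h1 h2 ⊢
    linarith
  have hδ : Tendsto (fun k : ℕ => (τ / 2 * ‖e‖ + 1) * (1 / ((k : ℝ) + 1))) atTop (𝓝 0) := by
    simpa using tendsto_one_div_add_atTop_nhds_zero_nat.const_mul (τ / 2 * ‖e‖ + 1)
  have hsupport : ∀ k, Function.support (mollify (ρ k) v) ⊆
      Metric.cthickening (ε k) ((fun x => x + t k • e) '' K) := fun k x hx => by
    obtain ⟨z, hz, hxz⟩ := exists_mem_of_mollify_ne_zero hv hx
    refine Metric.mem_cthickening_of_dist_le x (z + t k • e) _ _ ⟨z, hz, rfl⟩ ?_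
    have := (hmem k _ hxz).trans (min_le_left _ _)
    rwa [dist_eq_norm, sub_sub, ← dist_eq_norm] at this
  have htsupport : ∀ k, tsupport (mollify (ρ k) v) ⊆
      Metric.cthickening (ε k) ((fun x => x + t k • e) '' K) := fun k =>
    closure_minimal (hsupport k) Metric.isClosed_cthickening
  let φ : ℕ → 𝓓(Ω, ℝ) := fun k =>
    ⟨mollify (ρ k) v, contDiff_mollify (hρ k) v,
      (hKt k).cthickening.of_isClosed_subset (isClosed_tsupport _) (htsupport k),
      (htsupport k).trans (hεΩ k)⟩
  have hφ : ∀ k, ⇑(φ k) = mollify (ρ k) v := fun k => rfl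
  refine ⟨φ, tendsto_H10_iff.2 ⟨?_, ?_⟩, fun k q hq => ?_⟩
  · have h := tendsto_eLpNorm_convolution_sub (by norm_num) (by norm_num)
      (memLp_extVal v (memLp_val v)) hρ hδ hs
    refine tendsto_of_tendsto_of_tendsto_of_le_of_le tendsto_const_nhds h (fun _ => zero_le)
      fun k => ?_
    refine (eLpNorm_congr_ae ?_).le.trans (eLpNorm_mono_measure _ Measure.restrict_le_self)
    filter_upwards [val_ofTest_ae (φ k), extVal_ae v] with x h1 h2
    simp only [Pi.sub_apply, h1, h2]
    rfl
  · have h := tendsto_eLpNorm_convolution_sub (by norm_num) (by norm_num)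
      (memLp_extGrad v (memLp_grad v)) hρ hδ hs
    refine tendsto_of_tendsto_of_tendsto_of_le_of_le tendsto_const_nhds h (fun _ => zero_le)
      fun k => ?_
    refine (eLpNorm_congr_ae ?_).le.trans (eLpNorm_mono_measure _ Measure.restrict_le_self)
    filter_upwards [grad_ofTest_ae (φ k), extGrad_ae v] with x h1 h2
    simp only [Pi.sub_apply, h1, h2, hφ, gradient_mollify (hρ k)]
  · rw [← eLpNorm_extGrad, hφ, gradient_mollify (hρ k)]
    exact (eLpNorm_mono_measure _ Measure.restrict_le_self).trans
      ((hρ k).eLpNorm_convolution_le hq (memLp_extGrad v (memLp_grad v)).1)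

/-- Multiplication by a smooth function of compact support on `H¹₀(Ω)`. -/
lemma exists_mul (v : H10 Ω) {f : E N → ℝ} (hf : ContDiff ℝ ∞ f) (hc : HasCompactSupport f) :
    ∃ w : H10 Ω, val w =ᵐ[vol Ω] (fun x => f x * val v x) ∧
      grad w =ᵐ[vol Ω] fun x => f x • grad v x + val v x • gradient f x := by
  have hgc : Continuous (gradient f) :=
    (InnerProductSpace.toDual ℝ (E N)).symm.continuous.comp (hf.continuous_fderiv (by simp))
  have hgs : HasCompactSupport (gradient f) := (hc.fderiv (𝕜 := ℝ)).comp_left (map_zero _)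
  obtain ⟨C, hC⟩ := hf.continuous.bounded_above_of_compact_support hc
  obtain ⟨C', hC'⟩ := hgc.bounded_above_of_compact_support hgs
  have hm1 : MemLp (fun x => f x * val v x) 2 (vol Ω) :=
    (memLp_val v).of_le_mul (c := C)
      (hf.continuous.aestronglyMeasurable.mul (memLp_val v).1)
      (Eventually.of_forall fun x => by
        rw [norm_mul]; exact mul_le_mul_of_nonneg_right (hC x) (norm_nonneg _))
  have hm2 : MemLp (fun x => f x • grad v x) 2 (vol Ω) :=
    (memLp_grad v).of_le_mul (c := C)
      (hf.continuous.aestronglyMeasurable.smul (memLp_grad v).1)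
      (Eventually.of_forall fun x => by
        rw [norm_smul]; exact mul_le_mul_of_nonneg_right (hC x) (norm_nonneg _))
  have hm3 : MemLp (fun x => val v x • gradient f x) 2 (vol Ω) :=
    (memLp_val v).of_le_mul (c := C')
      ((memLp_val v).1.smul hgc.aestronglyMeasurable)
      (Eventually.of_forall fun x => by
        rw [norm_smul, mul_comm]; exact mul_le_mul_of_nonneg_right (hC' x) (norm_nonneg _))
  obtain ⟨φ, hφ⟩ := exists_tendsto_ofTest v
  obtain ⟨h1, h2⟩ := tendsto_H10_iff.1 hφ
  -- The cut-off `f` may cross the boundary; the product is still a test function on `Ω`, since `φ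
  -- k` supplies the support.
  let ψ : ℕ → 𝓓(Ω, ℝ) := fun k =>
    ⟨fun x => f x * φ k x, hf.mul (φ k).contDiff, hc.mul_right,
      (tsupport_mul_subset_right (f := f) (g := φ k)).trans (φ k).tsupport_subset⟩
  have hψ : ∀ k x, gradient (ψ k) x = f x • gradient (φ k) x + φ k x • gradient f x := by
    intro k x
    have h := fderiv_mul (𝕜 := ℝ) (hf.differentiable (by simp) x)
      ((φ k).contDiff.differentiable (by simp) x)
    have h' : fderiv ℝ (ψ k) x = f x • fderiv ℝ (φ k) x + φ k x • fderiv ℝ f x := h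
    simp only [gradient, h', map_add, map_smul]
  refine exists_H10_of_tendsto hm1 (hm2.add hm3) ψ ?_ ?_
  · have hlim := ENNReal.Tendsto.const_mul (a := ENNReal.ofReal C) h1 (Or.inr ENNReal.ofReal_ne_top)
    rw [mul_zero] at hlim
    refine tendsto_of_tendsto_of_tendsto_of_le_of_le tendsto_const_nhds hlim (fun _ => zero_le)
      fun k => ?_
    refine eLpNorm_le_mul_eLpNorm_of_ae_le_mul ?_ 2
    filter_upwards [val_ofTest_ae (φ k)] with x hx
    have : (⇑(ψ k) - fun x => f x * val v x) x = f x * (φ k x - val v x) := by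
      simp only [Pi.sub_apply, mul_sub]; rfl
    rw [this, Pi.sub_apply, hx, norm_mul]
    exact mul_le_mul_of_nonneg_right (hC x) (norm_nonneg _)
  · have hlim1 := ENNReal.Tendsto.const_mul (a := ENNReal.ofReal C') h1
      (Or.inr ENNReal.ofReal_ne_top)
    have hlim2 := ENNReal.Tendsto.const_mul (a := ENNReal.ofReal C) h2
      (Or.inr ENNReal.ofReal_ne_top)
    have hlim := hlim2.add hlim1
    rw [mul_zero, mul_zero, add_zero] at hlim
    refine tendsto_of_tendsto_of_tendsto_of_le_of_le tendsto_const_nhds hlim (fun _ => zero_le)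
      fun k => ?_
    have e1 : gradient (ψ k) - ((fun x => f x • grad v x) + fun x => val v x • gradient f x) =ᵐ[vol Ω]
        (fun x => f x • (grad (ofTest (φ k)) x - grad v x)) +
          fun x => (val (ofTest (φ k)) x - val v x) • gradient f x := by
      filter_upwards [val_ofTest_ae (φ k), grad_ofTest_ae (φ k)] with x hx hx'
      simp only [Pi.sub_apply, Pi.add_apply, hψ, hx, hx', smul_sub, sub_smul]
      abel
    refine (eLpNorm_congr_ae e1).trans_le ?_
    have m1 := (memLp_grad (ofTest (φ k))).1.sub (memLp_grad v).1
    have m2 := (memLp_val (ofTest (φ k))).1.sub (memLp_val v).1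
    refine (eLpNorm_add_le (hf.continuous.aestronglyMeasurable.smul m1)
      (m2.smul hgc.aestronglyMeasurable) (by norm_num)).trans (add_le_add ?_ ?_)
    · refine eLpNorm_le_mul_eLpNorm_of_ae_le_mul (Eventually.of_forall fun x => ?_) 2
      rw [Pi.smul_apply', norm_smul]
      exact mul_le_mul_of_nonneg_right (hC x) (norm_nonneg _)
    · refine eLpNorm_le_mul_eLpNorm_of_ae_le_mul (Eventually.of_forall fun x => ?_) 2
      rw [Pi.smul_apply', norm_smul, mul_comm]
      exact mul_le_mul_of_nonneg_right (hC' x) (norm_nonneg _)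

end Approximation

/-! ### Matrix fields acting on vector fields, Hölder bounds and weak convergence. -/

section MatrixFields

variable {N : ℕ} {Ω : Opens (E N)}

lemma app_apply (A : L2Mat Ω) (x ξ : E N) (i : Fin N) : app A x ξ i = ∑ j, A i j x * ξ j := rfl

lemma app_add_right (A : L2Mat Ω) (x ξ η : E N) : app A x (ξ + η) = app A x ξ + app A x η := by
  ext i; simp [app_apply, mul_add, Finset.sum_add_distrib]

lemma app_smul_right (A : L2Mat Ω) (x ξ : E N) (c : ℝ) : app A x (c • ξ) = c • app A x ξ := by
  ext i; simp [app_apply, Finset.mul_sum, mul_left_comm]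

lemma app_sub_right (A : L2Mat Ω) (x ξ η : E N) : app A x (ξ - η) = app A x ξ - app A x η := by
  ext i; simp [app_apply, mul_sub, Finset.sum_sub_distrib]

lemma app_zero_right (A : L2Mat Ω) (x : E N) : app A x 0 = 0 := by
  ext i; simp [app_apply]

lemma inner_app_transpose (A : L2Mat Ω) (x ξ η : E N) : ⟪ξ, app Aᵀ x η⟫ = ⟪app A x ξ, η⟫ := by
  simp only [PiLp.inner_apply, app_apply, transpose_apply, RCLike.inner_apply, conj_trivial,
    Finset.mul_sum, Finset.sum_mul]
  rw [Finset.sum_comm]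
  exact Finset.sum_congr rfl fun i _ => Finset.sum_congr rfl fun j _ => by ring

lemma app_add_left_ae (A B : L2Mat Ω) :
    ∀ᵐ x ∂(vol Ω), ∀ ξ, app (A + B) x ξ = app A x ξ + app B x ξ := by
  have h : ∀ᵐ x ∂(vol Ω), ∀ i j, (A + B) i j x = A i j x + B i j x := by
    simp only [eventually_all]
    exact fun i j => Lp.coeFn_add (A i j) (B i j)
  filter_upwards [h] with x hx ξ
  ext i
  simp only [app_apply, PiLp.add_apply, hx, add_mul, Finset.sum_add_distrib]

lemma app_sub_left_ae (A B : L2Mat Ω) :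
    ∀ᵐ x ∂(vol Ω), ∀ ξ, app (A - B) x ξ = app A x ξ - app B x ξ := by
  have h : ∀ᵐ x ∂(vol Ω), ∀ i j, (A - B) i j x = A i j x - B i j x := by
    simp only [eventually_all]
    exact fun i j => Lp.coeFn_sub (A i j) (B i j)
  filter_upwards [h] with x hx ξ
  ext i
  simp only [app_apply, PiLp.sub_apply, hx, sub_mul, Finset.sum_sub_distrib]

lemma app_smul_left_ae (c : ℝ) (A : L2Mat Ω) :
    ∀ᵐ x ∂(vol Ω), ∀ ξ, app (c • A) x ξ = c • app A x ξ := by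
  have h : ∀ᵐ x ∂(vol Ω), ∀ i j, (c • A) i j x = c * A i j x := by
    simp only [eventually_all]
    exact fun i j => Lp.coeFn_smul c (A i j)
  filter_upwards [h] with x hx ξ
  ext i
  simp only [app_apply, PiLp.smul_apply, smul_eq_mul, hx, Finset.mul_sum, mul_assoc]

lemma app_neg_left_ae (A : L2Mat Ω) : ∀ᵐ x ∂(vol Ω), ∀ ξ, app (-A) x ξ = -app A x ξ := by
  have := app_smul_left_ae (-1) A
  simpa only [neg_smul, one_smul] using this

lemma isSkew_skewPart (A : L2Mat Ω) : IsSkew (skewPart A) := by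
  simp [IsSkew, skewPart, transpose_sub, ← smul_neg]

lemma IsSkew.inner_app {K : L2Mat Ω} (hK : IsSkew K) :
    ∀ᵐ x ∂(vol Ω), ∀ ξ η, ⟪ξ, app K x η⟫ = -⟪app K x ξ, η⟫ := by
  filter_upwards [app_neg_left_ae K] with x hx ξ η
  rw [← inner_app_transpose, show Kᵀ = -K from hK, hx, inner_neg_right, neg_neg]

lemma symPart_transpose (A : L2Mat Ω) : (symPart A)ᵀ = symPart A := by
  simp [symPart, transpose_add, add_comm]

lemma symPart_add_skewPart (A : L2Mat Ω) : symPart A + skewPart A = A := by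
  rw [symPart, skewPart, ← smul_add, add_add_sub_cancel, ← two_smul ℝ, smul_smul]
  norm_num

lemma symPart_sub_skewPart (A : L2Mat Ω) : symPart A - skewPart A = Aᵀ := by
  rw [symPart, skewPart, ← smul_sub, add_sub_sub_cancel, ← two_smul ℝ, smul_smul]
  norm_num

lemma app_eq_sum (A : L2Mat Ω) (x ξ : E N) :
    app A x ξ = ∑ i, ∑ j, (A i j x * ξ j) • EuclideanSpace.single i (1 : ℝ) := by
  ext k
  simp [app_apply, ← Finset.sum_smul, Finset.sum_apply, Pi.single_apply]

/-- The sum of the absolute values of the entries. -/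
def entrySum (A : L2Mat Ω) (x : E N) : ℝ := ∑ i, ∑ j, |A i j x|

lemma entrySum_nonneg (A : L2Mat Ω) (x : E N) : 0 ≤ entrySum A x :=
  Finset.sum_nonneg fun _ _ => Finset.sum_nonneg fun _ _ => abs_nonneg _

lemma norm_app_le (A : L2Mat Ω) (x ξ : E N) : ‖app A x ξ‖ ≤ entrySum A x * ‖ξ‖ := by
  rw [app_eq_sum, entrySum, Finset.sum_mul]
  refine (norm_sum_le _ _).trans (Finset.sum_le_sum fun i _ => ?_)
  rw [Finset.sum_mul]
  refine (norm_sum_le _ _).trans (Finset.sum_le_sum fun j _ => ?_)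
  rw [norm_smul, norm_mul, Real.norm_eq_abs, PiLp.norm_single, norm_one, mul_one]
  exact mul_le_mul_of_nonneg_left (PiLp.norm_apply_le ξ j) (abs_nonneg _)

lemma memLp_entrySum {A : L2Mat Ω} {s : ℝ≥0∞} (h : ∀ i j, MemLp (A i j) s (vol Ω)) :
    MemLp (entrySum A) s (vol Ω) :=
  memLp_finsetSum _ fun i _ => memLp_finsetSum _ fun j _ => (h i j).abs

lemma memLp_entrySum_two (A : L2Mat Ω) : MemLp (entrySum A) 2 (vol Ω) :=
  memLp_entrySum fun _ _ => Lp.memLp _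

lemma aestronglyMeasurable_app (A : L2Mat Ω) {w : E N → E N}
    (hw : AEStronglyMeasurable w (vol Ω)) :
    AEStronglyMeasurable (fun x => app A x (w x)) (vol Ω) := by
  simp only [app_eq_sum]
  refine Finset.aestronglyMeasurable_fun_sum _ fun i _ =>
    Finset.aestronglyMeasurable_fun_sum _ fun j _ => ?_
  refine AEStronglyMeasurable.smul_const (((Lp.aestronglyMeasurable (A i j)).mul ?_)) _
  exact (EuclideanSpace.proj (𝕜 := ℝ) j).continuous.comp_aestronglyMeasurable hw

/-- `w ↦ Kw` is bounded from `L^q` to `L²`. -/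
def ActsBounded (K : L2Mat Ω) (q : ℝ≥0∞) : Prop :=
  ∃ C : ℝ≥0∞, C ≠ ⊤ ∧ ∀ w : E N → E N, AEStronglyMeasurable w (vol Ω) →
    eLpNorm (fun x => app K x (w x)) 2 (vol Ω) ≤ C * eLpNorm w q (vol Ω)

lemma ActsBounded.memLp {K : L2Mat Ω} {q : ℝ≥0∞} (h : ActsBounded K q) {w : E N → E N}
    (hw : MemLp w q (vol Ω)) : MemLp (fun x => app K x (w x)) 2 (vol Ω) := by
  obtain ⟨C, hC, hb⟩ := h
  exact ⟨aestronglyMeasurable_app K hw.1,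
    (hb w hw.1).trans_lt (ENNReal.mul_lt_top hC.lt_top hw.2)⟩

lemma actsBounded_of_abs_le {K B : L2Mat Ω} (hKB : ∀ i j, ∀ᵐ x ∂(vol Ω), |K i j x| ≤ |B i j x|)
    {s q : ℝ≥0∞} [ENNReal.HolderTriple s q 2] (hB : ∀ i j, MemLp (B i j) s (vol Ω)) :
    ActsBounded K q := by
  have hs := memLp_entrySum hB
  refine ⟨eLpNorm (entrySum B) s (vol Ω), hs.2.ne, fun w hw => ?_⟩
  refine le_trans (eLpNorm_mono_ae ?_) (eLpNorm_smul_le_mul_eLpNorm hw hs.1)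
  have h : ∀ᵐ x ∂(vol Ω), ∀ i j, |K i j x| ≤ |B i j x| := by
    simpa only [eventually_all] using hKB
  filter_upwards [h] with x hx
  rw [Pi.smul_apply', norm_smul, Real.norm_of_nonneg (entrySum_nonneg B x)]
  refine (norm_app_le K x (w x)).trans (mul_le_mul_of_nonneg_right ?_ (norm_nonneg _))
  exact Finset.sum_le_sum fun i _ => Finset.sum_le_sum fun j _ => hx i j

/-- Domination speaks of the entries above the diagonal only. Skewness makes the diagonal vanish and
reflects the bound below it. -/
lemma Dominated.abs_le {K B : L2Mat Ω} (h : Dominated K B) (hK : IsSkew K) (hB : IsSkew B)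
    (i j : Fin N) : ∀ᵐ x ∂(vol Ω), |K i j x| ≤ |B i j x| := by
  have hn : ∀ {M : L2Mat Ω}, IsSkew M → ∀ i j, ∀ᵐ x ∂(vol Ω), M j i x = -M i j x := by
    intro M hM i j
    have : M j i = -M i j := congrFun (congrFun hM i) j
    rw [this]
    exact Lp.coeFn_neg _
  rcases lt_trichotomy i j with hij | rfl | hij
  · exact h i j hij
  · filter_upwards [hn hK i i, hn hB i i] with x h1 h2
    rw [show K i i x = 0 by linarith, show B i i x = 0 by linarith]
  · filter_upwards [hn hK j i, hn hB j i, h j i hij] with x h1 h2 h3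
    rwa [h1, h2, abs_neg, abs_neg]

/-- The arithmetic is `γ/(2γ+4) + 2/(2γ+4) = 1/2`. This is why the regularity hypothesis pairs these
two exponents. -/
lemma holderTriple_two_add {γ : ℝ≥0∞} (hγ : 0 < γ) :
    ENNReal.HolderTriple (2 + 4 / γ) (2 + γ) 2 := by
  refine ⟨?_⟩
  rcases eq_or_ne γ ⊤ with rfl | h
  · simp
  lift γ to ℝ≥0 using h
  have h0 : γ ≠ 0 := by rintro rfl; simp at hγ
  have e1 : (2 + 4 / (γ : ℝ≥0∞))⁻¹ = ((2 + 4 / γ)⁻¹ : ℝ≥0) := by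
    rw [ENNReal.coe_inv (by positivity), ENNReal.coe_add, ENNReal.coe_div h0]; simp
  have e2 : (2 + (γ : ℝ≥0∞))⁻¹ = ((2 + γ)⁻¹ : ℝ≥0) := by
    rw [ENNReal.coe_inv (by positivity), ENNReal.coe_add]; simp
  have e3 : (2 : ℝ≥0∞)⁻¹ = ((2 : ℝ≥0)⁻¹ : ℝ≥0) := by
    rw [ENNReal.coe_inv (by positivity)]; simp
  rw [e1, e2, e3, ← ENNReal.coe_add]
  congr 1
  rw [← NNReal.coe_inj]
  have : (0 : ℝ) < γ := by positivity
  push_cast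
  field_simp
  ring

/-- For a regular `ψ`, fields dominated by `A^*` act boundedly on an `L^q` containing `∇ψ`. -/
lemma Data.Regular.exists_actsBounded {P : Data Ω} (hP : P.Standing) {ψ : H10 Ω}
    (hψ : P.Regular ψ) :
    ∃ q : ℝ≥0∞, 1 ≤ q ∧ MemLp (grad ψ) q (vol Ω) ∧
      ∀ K : L2Mat Ω, IsSkew K → Dominated K P.Astar → ActsBounded K q := by
  obtain ⟨γ, hγ, h | ⟨h1, h2⟩⟩ := hψ
  · refine ⟨⊤, le_top, h, fun K hK hd => ?_⟩
    have : ENNReal.HolderTriple 2 ⊤ 2 := ⟨by simp⟩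
    exact actsBounded_of_abs_le (hd.abs_le hK hP.Astar_skew) (s := 2) fun i j => Lp.memLp _
  · refine ⟨2 + γ, le_add_right (by norm_num), h2, fun K hK hd => ?_⟩
    have := holderTriple_two_add hγ
    exact actsBounded_of_abs_le (hd.abs_le hK hP.Astar_skew) h1

/-- Fields of vectors which are bounded after applying `K`, and converge to zero in `L²`, converge
to zero weakly in `L²` after applying `K`. -/
lemma tendsto_integral_inner_app (K : L2Mat Ω) (g : L2Vec Ω) {w : ℕ → E N → E N}
    (hw : ∀ k, MemLp (w k) 2 (vol Ω))
    (hw0 : Tendsto (fun k => eLpNorm (w k) 2 (vol Ω)) atTop (𝓝 0))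
    {C : ℝ≥0∞} (hC : C ≠ ⊤) (hb : ∀ k, eLpNorm (fun x => app K x (w k x)) 2 (vol Ω) ≤ C) :
    Tendsto (fun k => ∫ x in (Ω : Set (E N)), ⟪g x, app K x (w k x)⟫) atTop (𝓝 0) := by
  have hKw : ∀ k, MemLp (fun x => app K x (w k x)) 2 (vol Ω) := fun k =>
    ⟨aestronglyMeasurable_app K (hw k).1, (hb k).trans_lt hC.lt_top⟩
  have hCr : ∀ k, ‖(hKw k).toLp _‖ ≤ C.toReal := fun k => by
    rw [Lp.norm_toLp]; exact ENNReal.toReal_mono hC (hb k)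
  have e : ∀ k, ∫ x in (Ω : Set (E N)), ⟪g x, app K x (w k x)⟫ = ⟪g, (hKw k).toLp _⟫ := fun k => by
    rw [L2.inner_def]
    refine integral_congr_ae ?_
    filter_upwards [(hKw k).coeFn_toLp] with x hx
    rw [hx]
  simp only [e]
  rw [Metric.tendsto_atTop]
  intro ε hε
  -- Replacing `g` by a bounded `b` within this distance costs at most `ε/2` against images bounded
  -- by `C`; the `+ 1` covers `C = 0`. Against `b` the pairing is at most `‖b‖` times the `L²`-norms
  -- of the entries of `K` and of `w k`, which tends to zero.
  have hη : 0 < ε / (2 * (C.toReal + 1)) := by positivity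
  obtain ⟨b, hb1, hb2⟩ := (Lp.memLp g).exists_boundedContinuous_eLpNorm_sub_le (by norm_num)
    (ENNReal.ofReal_pos.2 hη).ne'
  have h1 : ‖g - hb2.toLp b‖ ≤ ε / (2 * (C.toReal + 1)) := by
    rw [← ENNReal.ofReal_le_ofReal_iff hη.le, ofReal_norm, Lp.enorm_def]
    refine (eLpNorm_congr_ae ?_).trans_le hb1
    filter_upwards [Lp.coeFn_sub g (hb2.toLp b), hb2.coeFn_toLp] with x h1 h2
    rw [h1, Pi.sub_apply, Pi.sub_apply, h2]
  let T : L2 Ω := (memLp_entrySum_two K).toLp _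
  have hwn : Tendsto (fun k => ‖((hw k).norm).toLp (fun x => ‖w k x‖)‖) atTop (𝓝 0) := by
    simp only [Lp.norm_toLp, eLpNorm_norm]
    exact (ENNReal.tendsto_toReal ENNReal.zero_ne_top).comp hw0
  have hlim : Tendsto (fun k => ‖b‖ * (‖T‖ * ‖((hw k).norm).toLp (fun x => ‖w k x‖)‖)) atTop
      (𝓝 0) := by
    simpa using (hwn.const_mul ‖T‖).const_mul ‖b‖
  obtain ⟨n, hn⟩ := (hlim.eventually (gt_mem_nhds (half_pos hε))).exists_forall_of_atTop
  refine ⟨n, fun k hk => ?_⟩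
  have h2 : |⟪hb2.toLp b, (hKw k).toLp _⟫| ≤ 
      ‖b‖ * (‖T‖ * ‖((hw k).norm).toLp (fun x => ‖w k x‖)‖) := by
    have h3 : ⟪T, ((hw k).norm).toLp (fun x => ‖w k x‖)⟫ ≤ _ := real_inner_le_norm _ _
    refine le_trans ?_ (mul_le_mul_of_nonneg_left h3 (norm_nonneg _))
    rw [L2.inner_def, L2.inner_def, ← integral_const_mul, ← Real.norm_eq_abs]
    refine norm_integral_le_of_norm_le ((L2.integrable_inner _ _).const_mul _) ?_
    filter_upwards [(hKw k).coeFn_toLp, hb2.coeFn_toLp, (memLp_entrySum_two K).coeFn_toLp,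
      ((hw k).norm).coeFn_toLp] with x h4 h5 h6 h7
    have e6 : T x = entrySum K x := h6
    rw [h4, h5, e6, h7]
    refine (norm_inner_le_norm _ _).trans ?_
    have h8 : ⟪entrySum K x, ‖w k x‖⟫ = entrySum K x * ‖w k x‖ := by simp [mul_comm]
    rw [h8]
    exact mul_le_mul (b.norm_coe_le_norm x) (norm_app_le _ _ _) (norm_nonneg _) (norm_nonneg _)
  have h3 : |⟪g - hb2.toLp b, (hKw k).toLp _⟫| ≤ ε / (2 * (C.toReal + 1)) * C.toReal :=
    (abs_real_inner_le_norm _ _).trans (mul_le_mul h1 (hCr k) (norm_nonneg _) hη.le)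
  have h4 : ε / (2 * (C.toReal + 1)) * C.toReal ≤ ε / 2 := by
    have : (0 : ℝ) ≤ C.toReal := ENNReal.toReal_nonneg
    rw [div_mul_eq_mul_div, div_le_div_iff₀ (by positivity) (by positivity)]
    nlinarith
  have h5 := hn k hk
  have h6 : ⟪g, (hKw k).toLp _⟫ = ⟪g - hb2.toLp b, (hKw k).toLp _⟫ + ⟪hb2.toLp b, (hKw k).toLp _⟫ := by
    rw [inner_sub_left]; ring
  rw [Real.dist_eq, sub_zero, h6]
  exact (abs_add_le _ _).trans_lt (by linarith)

end MatrixFields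

/-! ### Inward translation at the boundary of a Lipschitz domain. -/

section Lipschitz

variable {N : ℕ} {Ω : Opens (E N)}

/-- Near each point of `closure Ω`, the closure of a Lipschitz domain can be translated into the
domain by small multiples of a fixed vector. -/
lemma HasLipschitzBoundary.exists_translate (hLip : HasLipschitzBoundary Ω) {x₀ : E N}
    (hx₀ : x₀ ∈ closure (Ω : Set (E N))) :
    ∃ r > (0 : ℝ), ∃ e : E N, ∃ τ > (0 : ℝ), ∀ x ∈ closure (Ω : Set (E N)),
      x ∈ Metric.closedBall x₀ r → ∀ t : ℝ, 0 < t → t < τ → x + t • e ∈ Ω := by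
  by_cases hmem : x₀ ∈ Ω
  · obtain ⟨r, hr, hsub⟩ := Metric.isOpen_iff.1 Ω.isOpen x₀ hmem
    -- At an interior point no translation is needed, so `e = 0` and any positive `τ` will do.
    refine ⟨r / 2, half_pos hr, 0, 1, one_pos, fun x _ hx t _ _ => ?_⟩
    rw [smul_zero, add_zero]
    exact hsub (Metric.closedBall_subset_ball (half_lt_self hr) hx)
  have hfr : x₀ ∈ frontier (Ω : Set (E N)) := by
    rw [Ω.isOpen.frontier_eq]; exact ⟨hx₀, hmem⟩
  obtain ⟨r, hr, e, he, g, K, hg, h⟩ := hLip x₀ hfr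
  -- Points of the half ball moved by less than `r / 2` stay in the ball where the graph description
  -- holds. On the closure the graph inequality holds non-strictly; moving along `e` keeps the base
  -- point and raises the height by `t`, which makes it strict.
  refine ⟨r / 2, half_pos hr, e, r / 2, half_pos hr, fun x hxΩ hx t ht0 ht => ?_⟩
  have hxb : x ∈ Metric.ball x₀ r := Metric.closedBall_subset_ball (half_lt_self hr) hx
  have hxg : g (x - ⟪e, x⟫ • e) ≤ ⟪e, x⟫ := by
    have hcl : IsClosed {z : E N | g (z - ⟪e, z⟫ • e) ≤ ⟪e, z⟫} :=
      isClosed_le (hg.continuous.comp (by fun_prop)) (by fun_prop)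
    have hsub : Metric.ball x₀ r ∩ closure (Ω : Set (E N)) ⊆
        {z : E N | g (z - ⟪e, z⟫ • e) ≤ ⟪e, z⟫} := by
      refine Metric.isOpen_ball.inter_closure.trans (closure_minimal ?_ hcl)
      rintro z ⟨hz1, hz2⟩
      exact ((h z hz1).1 hz2).le
    exact hsub ⟨hxb, hxΩ⟩
  have hball : x + t • e ∈ Metric.ball x₀ r := by
    rw [Metric.mem_ball]
    have h1 : dist (x + t • e) x = t := by
      rw [dist_eq_norm, add_sub_cancel_left, norm_smul, he, mul_one, Real.norm_of_nonneg ht0.le]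
    have h2 : dist x x₀ ≤ r / 2 := hx
    linarith [dist_triangle (x + t • e) x x₀]
  rw [h _ hball]
  have hin : ⟪e, x + t • e⟫ = ⟪e, x⟫ + t := by
    rw [inner_add_right, inner_smul_right, real_inner_self_eq_norm_sq, he]; ring
  have hpr : x + t • e - (⟪e, x⟫ + t) • e = x - ⟪e, x⟫ • e := by
    rw [add_smul]; abel
  rw [hin, hpr]
  linarith

end Lipschitz

/-! ### Extending an integral representation from test functions to `H¹₀` elements with gradient in
`L^q`. -/

section IntegrationByParts

variable {N : ℕ} {Ω : Opens (E N)} {K : L2Mat Ω} {q : ℝ≥0∞}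

lemma integrable_inner_app {g : L2Vec Ω} {w : E N → E N}
    (h : MemLp (fun x => app K x (w x)) 2 (vol Ω)) :
    Integrable (fun x => ⟪g x, app K x (w x)⟫) (vol Ω) := by
  refine (L2.integrable_inner (𝕜 := ℝ) g (h.toLp _)).congr ?_
  filter_upwards [h.coeFn_toLp] with x hx
  rw [hx]

lemma grad_sub_ae (v w : H10 Ω) : grad (v - w) =ᵐ[vol Ω] fun x => grad v x - grad w x := by
  have : grad (v - w) = grad v - grad w := (gradL Ω).map_sub v w
  rw [this]
  exact Lp.coeFn_sub _ _

lemma val_sub_ae (v w : H10 Ω) : val (v - w) =ᵐ[vol Ω] fun x => val v x - val w x := by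
  have : val (v - w) = val v - val w := (valL Ω).map_sub v w
  rw [this]
  exact Lp.coeFn_sub _ _

variable (hq : 1 ≤ q) (hK : ActsBounded K q) {g : L2Vec Ω} {ℓ : StrongDual ℝ (H10 Ω)}
  (hℓ : ∀ φ : 𝓓(Ω, ℝ), ℓ (ofTest φ) = ∫ x in (Ω : Set (E N)), ⟪g x, app K x (gradient φ x)⟫)
include hK hℓ

include hq in
/-- The identity of `ℓ` with the integral functional extends to elements of `H¹₀(Ω)` supported in a
set that can be translated into `Ω`. -/
lemma apply_eq_of_translate {v : H10 Ω} (hvq : MemLp (grad v) q (vol Ω))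
    {S : Set (E N)} (hS : IsCompact S) (hv : ∀ᵐ z, z ∉ S → extVal v z = 0) {e : E N} {τ : ℝ}
    (hτ : 0 < τ) (he : ∀ x ∈ S, ∀ t : ℝ, 0 < t → t < τ → x + t • e ∈ Ω) :
    ℓ v = ∫ x in (Ω : Set (E N)), ⟪g x, app K x (grad v x)⟫ := by
  obtain ⟨φ, hφ, hφq⟩ := exists_approximation_of_translate hS hv hτ he
  obtain ⟨-, hφ2⟩ := tendsto_H10_iff.1 hφ
  obtain ⟨C, hC, hCb⟩ := id hK
  have hw : ∀ k, AEStronglyMeasurable (fun x => gradient (φ k) x - grad v x) (vol Ω) := fun k =>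
    (memLp_gradient (φ k) 2).1.sub (memLp_grad v).1
  -- The gradients converge in `L²` but are only bounded in `L^q`. Hence their images under `K` are
  -- bounded in `L²`, and pairing with the fixed `g` needs no more.
  have hlim := tendsto_integral_inner_app K g (w := fun k x => gradient (φ k) x - grad v x)
    (fun k => (memLp_gradient (φ k) 2).sub (memLp_grad v))
    (hφ2.congr fun k => eLpNorm_congr_ae (by
      filter_upwards [grad_ofTest_ae (φ k)] with x hx
      rw [Pi.sub_apply, hx]))
    (C := C * (eLpNorm (grad v) q (vol Ω) + eLpNorm (grad v) q (vol Ω)))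
    (ENNReal.mul_ne_top hC (ENNReal.add_ne_top.2 ⟨hvq.2.ne, hvq.2.ne⟩))
    (fun k => (hCb _ (hw k)).trans (by
      gcongr
      refine (eLpNorm_sub_le (memLp_gradient (φ k) 2).1 (memLp_grad v).1 hq).trans ?_
      gcongr
      exact hφq k q hq))
  have h1 : Tendsto (fun k => ℓ (ofTest (φ k)) -
      ∫ x in (Ω : Set (E N)), ⟪g x, app K x (grad v x)⟫) atTop (𝓝 0) := by
    refine hlim.congr fun k => ?_
    rw [hℓ, ← integral_sub (integrable_inner_app (hK.memLp (memLp_gradient (φ k) q)))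
      (integrable_inner_app (hK.memLp hvq))]
    simp only [app_sub_right, inner_sub_right]
  have h2 := ((ℓ.continuous.tendsto v).comp hφ).sub_const
    (∫ x in (Ω : Set (E N)), ⟪g x, app K x (grad v x)⟫)
  exact sub_eq_zero.1 (tendsto_nhds_unique h2 h1)

include hq in
/-- On a Lipschitz domain, the identity of `ℓ` with the integral functional extends from test
functions to all elements of `H¹₀(Ω)` with gradient in `L^q`. -/
lemma apply_eq_integral (hN : 2 ≤ N) (hbdd : Bornology.IsBounded (Ω : Set (E N)))
    (hLip : HasLipschitzBoundary Ω) {ψ : H10 Ω} (hψ : MemLp (grad ψ) q (vol Ω)) :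
    ℓ ψ = ∫ x in (Ω : Set (E N)), ⟪g x, app K x (grad ψ x)⟫ := by
  choose! r hr e τ hτ htr using fun x₀ (h : x₀ ∈ closure (Ω : Set (E N))) =>
    hLip.exists_translate h
  obtain ⟨C₀, hC₀⟩ := exists_eLpNorm_val_le hN hbdd
  have hcpt : IsCompact (closure (Ω : Set (E N))) := hbdd.isCompact_closure
  -- A partition of unity by induction on the balls carrying `v`: a bump `f` equal to `1` on one
  -- half ball splits off `f v`, which can be translated inward, and `v - f v` is carried by the
  -- remaining half balls.
  have step : ∀ s : Finset (E N), (∀ c ∈ s, c ∈ closure (Ω : Set (E N))) → ∀ v : H10 Ω,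
      MemLp (grad v) q (vol Ω) →
      (∀ᵐ z ∂(vol Ω), (∀ c ∈ s, z ∉ Metric.ball c (r c / 2)) → val v z = 0 ∧ grad v z = 0) →
      ℓ v = ∫ x in (Ω : Set (E N)), ⟪g x, app K x (grad v x)⟫ := by
    intro s
    induction s using Finset.induction_on with
    | empty =>
      intro _ v _ hv
      have h0 : v = 0 := ext_val_grad
        (Lp.ext (EventuallyEq.trans (hv.mono fun z hz => (hz (by simp)).1)
          (Lp.coeFn_zero ℝ 2 (vol Ω)).symm))
        (Lp.ext (EventuallyEq.trans (hv.mono fun z hz => (hz (by simp)).2)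
          (Lp.coeFn_zero (E N) 2 (vol Ω)).symm))
      rw [h0, map_zero, eq_comm]
      refine integral_eq_zero_of_ae ?_
      filter_upwards [Lp.coeFn_zero (E N) 2 (vol Ω)] with x hx
      have : grad (0 : H10 Ω) x = 0 := hx
      simp [this, app_zero_right]
    | insert c s _ ih =>
      intro hs v hvq hv
      have hc := hs c (Finset.mem_insert_self c s)
      have hrc := hr c hc
      let f : ContDiffBump c := ⟨r c / 2, r c, half_pos hrc, half_lt_self hrc⟩
      have hfs : ContDiff ℝ ∞ f := f.contDiff
      have hfc : HasCompactSupport f := f.hasCompactSupport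
      have hgc : Continuous (gradient f) :=
        (InnerProductSpace.toDual ℝ (E N)).symm.continuous.comp (hfs.continuous_fderiv (by simp))
      have hgs : HasCompactSupport (gradient f) := (hfc.fderiv (𝕜 := ℝ)).comp_left (map_zero _)
      obtain ⟨B, hB⟩ := hfs.continuous.bounded_above_of_compact_support hfc
      obtain ⟨B', hB'⟩ := hgc.bounded_above_of_compact_support hgs
      obtain ⟨w, hw1, hw2⟩ := exists_mul v hfs hfc
      -- Poincaré's inequality in `L^q` enters here: the gradient of `f v` contains `v ∇f`, so `v`
      -- itself must lie in `L^q`.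
      have hvalq : MemLp (val v) q (vol Ω) := ⟨(memLp_val v).1,
        (hC₀ v q hq).trans_lt (ENNReal.mul_lt_top ENNReal.ofReal_lt_top hvq.2)⟩
      have hwq : MemLp (grad w) q (vol Ω) := by
        rw [memLp_congr_ae hw2]
        refine MemLp.add (f := fun x => f x • grad v x) (g := fun x => val v x • gradient f x) ?_ ?_
        · exact hvq.of_le_mul (c := B) (hfs.continuous.aestronglyMeasurable.smul hvq.1)
            (Eventually.of_forall fun x => by
              rw [norm_smul]; exact mul_le_mul_of_nonneg_right (hB x) (norm_nonneg _))
        · exact hvalq.of_le_mul (c := B') (hvalq.1.smul hgc.aestronglyMeasurable)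
            (Eventually.of_forall fun x => by
              rw [norm_smul, mul_comm]
              exact mul_le_mul_of_nonneg_right (hB' x) (norm_nonneg _))
      have hvwq : MemLp (grad (v - w)) q (vol Ω) := by
        rw [memLp_congr_ae (grad_sub_ae v w)]; exact hvq.sub hwq
      have good_w : ℓ w = ∫ x in (Ω : Set (E N)), ⟪g x, app K x (grad w x)⟫ := by
        refine apply_eq_of_translate hq hK hℓ hwq
          (S := closure (Ω : Set (E N)) ∩ Metric.closedBall c (r c))
          (hcpt.inter_right Metric.isClosed_closedBall) ?_ (hτ c hc)
          (fun x hx => htr c hc x hx.1 hx.2)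
        filter_upwards [(ae_restrict_iff' Ω.isOpen.measurableSet).1 hw1] with z hz hzS
        by_cases hzΩ : z ∈ (Ω : Set (E N))
        · have hzb : z ∉ Metric.closedBall c (r c) := fun h => hzS ⟨subset_closure hzΩ, h⟩
          have hfz : f z = 0 := f.zero_of_le_dist (by
            rw [Metric.mem_closedBall, not_le] at hzb; exact hzb.le)
          rw [extVal, Set.indicator_of_mem hzΩ, hz hzΩ, hfz, zero_mul]
        · exact Set.indicator_of_notMem hzΩ _
      have good_vw := ih (fun c' hc' => hs c' (Finset.mem_insert_of_mem hc')) (v - w) hvwq (by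
        filter_upwards [hv, hw1, hw2, grad_sub_ae v w, val_sub_ae v w] with z h1 h2 h3 h4 h5 hz
        rw [h4, h5, h2, h3]
        by_cases hzc : z ∈ Metric.ball c (r c / 2)
        · have hf1 : f z = 1 := f.one_of_mem_closedBall (Metric.ball_subset_closedBall hzc)
          have hf2 : gradient f z = 0 := by
            have : (f : E N → ℝ) =ᶠ[𝓝 z] fun _ => 1 := by
              filter_upwards [Metric.isOpen_ball.mem_nhds hzc] with y hy
              exact f.one_of_mem_closedBall (Metric.ball_subset_closedBall hy)
            simp [gradient, this.fderiv_eq]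
          simp [hf1, hf2]
        · obtain ⟨h6, h7⟩ := h1 fun c' hc' => by
            rcases Finset.mem_insert.1 hc' with rfl | h
            · exact hzc
            · exact hz c' h
          simp [h6, h7])
      have hsplit : v = w + (v - w) := by abel
      calc ℓ v = ℓ w + ℓ (v - w) := by rw [← map_add, ← hsplit]
        _ = _ := by
          rw [good_w, good_vw, ← integral_add (integrable_inner_app (hK.memLp hwq))
            (integrable_inner_app (hK.memLp hvwq))]
          refine integral_congr_ae ?_
          filter_upwards [grad_sub_ae v w] with x hx
          rw [hx, app_sub_right, ← inner_add_right, add_sub_cancel]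
  obtain ⟨s, hs, hcov⟩ := hcpt.elim_nhds_subcover (fun c => Metric.ball c (r c / 2))
    fun c hc => Metric.ball_mem_nhds c (half_pos (hr c hc))
  refine step s hs ψ hψ ?_
  filter_upwards [ae_restrict_mem Ω.isOpen.measurableSet] with z hz hzs
  obtain ⟨c, hc, hzc⟩ := Set.mem_iUnion₂.1 (hcov (subset_closure hz))
  exact absurd hzc (hzs c hc)

end IntegrationByParts

/-! ### The form `[y, ·]_A` as a continuous functional. -/

section Bracket

variable {N : ℕ} {Ω : Opens (E N)}

/-- Entries in `L²` suffice when the vector field is bounded, as gradients of test functions are. -/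
lemma actsBounded_top (K : L2Mat Ω) : ActsBounded K ⊤ := by
  have : ENNReal.HolderTriple 2 ⊤ 2 := ⟨by simp⟩
  exact actsBounded_of_abs_le (B := K) (fun _ _ => Eventually.of_forall fun _ => le_rfl) (s := 2)
    fun i j => Lp.memLp _

lemma skewForm_eq (A : L2Mat Ω) (y : H10 Ω) (φ : 𝓓(Ω, ℝ)) :
    skewForm A y φ =
      -∫ x in (Ω : Set (E N)), ⟪grad y x, app (skewPart A) x (gradient φ x)⟫ := by
  rw [skewForm, ← integral_neg]
  refine integral_congr_ae ?_
  filter_upwards [(isSkew_skewPart A).inner_app] with x hx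
  rw [hx, real_inner_comm]

lemma integrable_inner_app_gradient (K : L2Mat Ω) (g : L2Vec Ω) (φ : 𝓓(Ω, ℝ)) :
    Integrable (fun x => ⟪g x, app K x (gradient φ x)⟫) (vol Ω) :=
  integrable_inner_app ((actsBounded_top K).memLp (memLp_gradient φ ⊤))

lemma gradient_test_add (φ ψ : 𝓓(Ω, ℝ)) (x : E N) :
    gradient (φ + ψ : 𝓓(Ω, ℝ)) x = gradient φ x + gradient ψ x := by
  have := fderiv_add (𝕜 := ℝ) (x := x) (φ.contDiff.differentiable (by simp) x)
    (ψ.contDiff.differentiable (by simp) x)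
  simp only [gradient, ← map_add]
  rw [← this]
  rfl

lemma gradient_test_smul (c : ℝ) (φ : 𝓓(Ω, ℝ)) (x : E N) :
    gradient (c • φ : 𝓓(Ω, ℝ)) x = c • gradient φ x := by
  have := fderiv_const_smul (𝕜 := ℝ) (x := x) (φ.contDiff.differentiable (by simp) x) c
  simp only [gradient, ← map_smul]
  rw [← this]
  rfl

/-- The form `φ ↦ ∫_Ω (∇φ, A^{skew} ∇y) dx` as a linear map. -/
def skewFormL (A : L2Mat Ω) (y : H10 Ω) : 𝓓(Ω, ℝ) →ₗ[ℝ] ℝ where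
  toFun := skewForm A y
  map_add' φ ψ := by
    simp only [skewForm_eq, gradient_test_add, app_add_right, inner_add_right]
    rw [integral_add (integrable_inner_app_gradient _ _ _) (integrable_inner_app_gradient _ _ _),
      neg_add]
  map_smul' c φ := by
    simp only [skewForm_eq, gradient_test_smul, app_smul_right, inner_smul_right, RingHom.id_apply,
      integral_const_mul, smul_eq_mul, mul_neg]

lemma sqrt_integral_gradient (φ : 𝓓(Ω, ℝ)) :
    Real.sqrt (∫ x in (Ω : Set (E N)), ‖gradient φ x‖ ^ 2) = ‖grad (ofTest φ)‖ := by
  rw [← Real.sqrt_sq (norm_nonneg (grad (ofTest φ))), ← real_inner_self_eq_norm_sq, L2.inner_def]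
  congr 1
  refine integral_congr_ae ?_
  filter_upwards [grad_ofTest_ae φ] with x hx
  rw [hx, real_inner_self_eq_norm_sq]

/-- For `y ∈ D(A)`, the form `[y, ·]_A` is the continuous extension of the skew form. -/
lemma exists_dual_eq_bracket {A : L2Mat Ω} {y : H10 Ω} (hy : y ∈ D A) :
    ∃ ℓ : StrongDual ℝ (H10 Ω), (∀ φ : 𝓓(Ω, ℝ), ℓ (ofTest φ) = skewForm A y φ) ∧
      ∀ v, bracket A y v = ℓ v := by
  obtain ⟨c, hc⟩ := hy
  let ℓ : StrongDual ℝ (H10 Ω) := (skewFormL A y).extendOfNorm (ofTestL Ω)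
  have hℓ : ∀ φ : 𝓓(Ω, ℝ), ℓ (ofTest φ) = skewForm A y φ := fun φ =>
    LinearMap.extendOfNorm_eq (f := skewFormL A y) (e := ofTestL Ω) denseRange_ofTest
      -- The bound in `D A` uses only the gradient, whose norm is dominated by the `H¹`-norm; the
      -- absolute value is taken because `c` is not assumed non-negative.
      ⟨|c|, fun φ => by
        refine (hc φ).trans ?_
        rw [sqrt_integral_gradient]
        exact mul_le_mul (le_abs_self c) (WithLp.norm_snd_le _ (ofTest φ).1) (norm_nonneg _)
          (abs_nonneg _)⟩ φ
  refine ⟨ℓ, hℓ, fun v => ?_⟩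
  -- Density of test functions makes the filter nontrivial, so the limit defining the form is
  -- unique.
  have : (comap (ofTest : 𝓓(Ω, ℝ) → H10 Ω) (𝓝 v)).NeBot := comap_neBot fun t ht => by
    obtain ⟨-, h, φ, rfl⟩ := mem_closure_iff_nhds.1 (denseRange_ofTest v) t ht
    exact ⟨φ, h⟩
  refine Tendsto.limUnder_eq ?_
  have h : skewForm A y = ℓ ∘ ofTest := funext fun φ => (hℓ φ).symm
  rw [h]
  exact (ℓ.continuous.tendsto v).comp tendsto_comap

end Bracket

/-! ### Admissible controls: integral form of the bracket, the symmetric operator, convexity. -/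

section Controls

variable {N : ℕ} {Ω : Opens (E N)} {P : Data Ω}

/-- On regular elements, the form `[y, ·]_A` is given by an integral. -/
lemma bracket_eq_neg_integral (hP : P.Standing) (hN : 2 ≤ N)
    (hbdd : Bornology.IsBounded (Ω : Set (E N))) (hLip : HasLipschitzBoundary Ω) {A : L2Mat Ω}
    (hA : A ∈ P.Admissible) {y ψ : H10 Ω} (hy : y ∈ D A) (hψ : P.Regular ψ) :
    bracket A y ψ = -∫ x in (Ω : Set (E N)), ⟪grad y x, app (skewPart A) x (grad ψ x)⟫ := by
  obtain ⟨ℓ, hℓ, hb⟩ := exists_dual_eq_bracket hy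
  obtain ⟨q, hq, hψq, hact⟩ := hψ.exists_actsBounded hP
  -- The sign comes from skewness, which moves the matrix from `∇y` onto the gradient of the test
  -- function.
  have h := apply_eq_integral (K := skewPart A) (g := grad y) (ℓ := -ℓ) hq
    (hact _ (isSkew_skewPart A) hA.2.1) (fun φ => by
      rw [_root_.neg_apply, hℓ, skewForm_eq, neg_neg]) hN hbdd hLip hψq
  rw [hb, ← h, _root_.neg_apply, neg_neg]

lemma memLp_skewPart_app (hP : P.Standing) {A : L2Mat Ω} (hA : A ∈ P.Admissible) {ψ : H10 Ω}
    (hψ : P.Regular ψ) : MemLp (fun x => app (skewPart A) x (grad ψ x)) 2 (vol Ω) := by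
  obtain ⟨q, hq, hψq, hact⟩ := hψ.exists_actsBounded hP
  exact (hact _ (isSkew_skewPart A) hA.2.1).memLp hψq

/-- A symmetric positive field with quadratic form bounded by `β` has operator norm at most `β`. -/
lemma norm_app_le_of_form_le {S : L2Mat Ω} (hS : Sᵀ = S) {β : ℝ} (hβ : 0 < β) {x : E N}
    (h0 : ∀ ξ : E N, 0 ≤ ⟪app S x ξ, ξ⟫) (h1 : ∀ ξ : E N, ⟪app S x ξ, ξ⟫ ≤ β * ‖ξ‖ ^ 2) (ξ : E N) :
    ‖app S x ξ‖ ≤ β * ‖ξ‖ := by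
  have hsym : ∀ ξ η : E N, ⟪ξ, app S x η⟫ = ⟪app S x ξ, η⟫ := fun ξ η => by
    conv_lhs => rw [← hS]
    exact inner_app_transpose S x ξ η
  -- Polarisation with this `η`, using the upper bound at `ξ + η` and positivity at `ξ - η`, gives
  -- `4 β ‖η‖² ≤ β (‖ξ‖ + ‖η‖)²`, hence `‖η‖ ≤ ‖ξ‖`.
  let η : E N := β⁻¹ • app S x ξ
  have e1 : ⟪app S x ξ, η⟫ = β⁻¹ * ‖app S x ξ‖ ^ 2 := by
    rw [inner_smul_right, real_inner_self_eq_norm_sq]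
  have e2 : ⟪app S x (ξ + η), ξ + η⟫ - ⟪app S x (ξ - η), ξ - η⟫ = 4 * ⟪app S x ξ, η⟫ := by
    have : ⟪app S x η, ξ⟫ = ⟪app S x ξ, η⟫ := by rw [← hsym, real_inner_comm]
    simp only [app_add_right, app_sub_right, inner_add_left, inner_add_right, inner_sub_left,
      inner_sub_right, this]
    ring
  have e3 : ‖η‖ = β⁻¹ * ‖app S x ξ‖ := by
    rw [norm_smul, Real.norm_of_nonneg (inv_nonneg.2 hβ.le)]
  have h2 := h1 (ξ + η)
  have h3 := h0 (ξ - η)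
  have h4 : ‖ξ + η‖ ^ 2 ≤ (‖ξ‖ + ‖η‖) ^ 2 := by gcongr; exact norm_add_le _ _
  have e4 : ‖app S x ξ‖ = β * ‖η‖ := by rw [e3]; field_simp
  have e5 : ⟪app S x ξ, η⟫ = β * ‖η‖ ^ 2 := by rw [e1, e4]; field_simp
  rw [e4]
  refine mul_le_mul_of_nonneg_left ?_ hβ.le
  have h5 : β * (4 * ‖η‖ ^ 2) ≤ β * (‖ξ‖ + ‖η‖) ^ 2 := by nlinarith
  have h6 := le_of_mul_le_mul_left h5 hβ
  have h7 : (2 * ‖η‖) ^ 2 ≤ (‖ξ‖ + ‖η‖) ^ 2 := by linarith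
  have h8 := (sq_le_sq₀ (by positivity) (by positivity)).1 h7
  linarith

/-- The operator `u ↦ A^{sym} u` on `L²(Ω; ℝ^N)` of an admissible control. -/
lemma exists_symOp (hP : P.Standing) {A : L2Mat Ω} (hA : A ∈ P.Admissible) :
    ∃ T : L2Vec Ω →L[ℝ] L2Vec Ω, (∀ u : L2Vec Ω, T u =ᵐ[vol Ω] fun x => app (symPart A) x (u x)) ∧
      (∀ u v : L2Vec Ω, ⟪T u, v⟫ = ⟪u, T v⟫) ∧ ∀ u : L2Vec Ω, P.α * ‖u‖ ^ 2 ≤ ⟪T u, u⟫ := by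
  have hβ : 0 < P.β := hP.α_pos.trans_le hP.α_le_β
  have hform := hA.1.2
  have hb : ∀ᵐ x ∂(vol Ω), ∀ ξ, ‖app (symPart A) x ξ‖ ≤ P.β * ‖ξ‖ := by
    filter_upwards [hform] with x hx ξ
    exact norm_app_le_of_form_le (symPart_transpose A) hβ
      (fun η => (mul_nonneg hP.α_pos.le (sq_nonneg _)).trans (hx η).1) (fun η => (hx η).2) ξ
  have hm : ∀ u : L2Vec Ω, MemLp (fun x => app (symPart A) x (u x)) 2 (vol Ω) := fun u =>
    (Lp.memLp u).of_le_mul (c := P.β) (aestronglyMeasurable_app _ (Lp.aestronglyMeasurable u))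
      (hb.mono fun x hx => hx _)
  let T₀ : L2Vec Ω →ₗ[ℝ] L2Vec Ω :=
    { toFun := fun u => (hm u).toLp _
      map_add' := fun u v => by
        rw [← MemLp.toLp_add]
        refine MemLp.toLp_congr _ _ ?_
        filter_upwards [Lp.coeFn_add u v] with x hx
        rw [hx, Pi.add_apply, app_add_right, Pi.add_apply]
      map_smul' := fun c u => by
        rw [RingHom.id_apply, ← MemLp.toLp_const_smul]
        refine MemLp.toLp_congr _ _ ?_
        filter_upwards [Lp.coeFn_smul c u] with x hx
        rw [hx, Pi.smul_apply, app_smul_right, Pi.smul_apply] }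
  let T : L2Vec Ω →L[ℝ] L2Vec Ω := T₀.mkContinuous P.β fun u =>
    Lp.norm_le_mul_norm_of_ae_le_mul (by
      filter_upwards [hb, (hm u).coeFn_toLp] with x hx h
      change ‖(hm u).toLp _ x‖ ≤ _
      rw [h]
      exact hx _)
  have hT : ∀ u, T u =ᵐ[vol Ω] fun x => app (symPart A) x (u x) := fun u => (hm u).coeFn_toLp
  refine ⟨T, hT, fun u v => ?_, fun u => ?_⟩
  · rw [L2.inner_def, L2.inner_def]
    refine integral_congr_ae ?_
    filter_upwards [hT u, hT v] with x h1 h2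
    rw [h1, h2, ← inner_app_transpose, symPart_transpose]
  · rw [← real_inner_self_eq_norm_sq, L2.inner_def, L2.inner_def, ← integral_const_mul]
    refine integral_mono_ae ((L2.integrable_inner u u).const_mul _) (L2.integrable_inner (T u) u) ?_
    filter_upwards [hT u, hform] with x h1 h2
    simp only [h1, real_inner_self_eq_norm_sq]
    exact (h2 _).1

lemma symPart_segment (A B : L2Mat Ω) (θ : ℝ) :
    symPart (Data.segment A B θ) = Data.segment (symPart A) (symPart B) θ := by
  simp only [symPart, Data.segment, transpose_add, transpose_smul, transpose_sub]
  module

lemma skewPart_segment (A B : L2Mat Ω) (θ : ℝ) :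
    skewPart (Data.segment A B θ) = Data.segment (skewPart A) (skewPart B) θ := by
  simp only [skewPart, Data.segment, transpose_add, transpose_smul, transpose_sub]
  module

lemma app_segment_ae (A B : L2Mat Ω) (θ : ℝ) :
    ∀ᵐ x ∂(vol Ω), ∀ ξ, app (Data.segment A B θ) x ξ = app A x ξ + θ • (app B x ξ - app A x ξ) := by
  filter_upwards [app_add_left_ae A (θ • (B - A)), app_smul_left_ae θ (B - A),
    app_sub_left_ae B A] with x h1 h2 h3 ξ
  rw [Data.segment, h1, h2, h3]

lemma integral_mul_divergence_le {a : L2 Ω} {c : ℝ} (hc : 0 ≤ c)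
    (h : totalVariation a ≤ ENNReal.ofReal c) (φ : 𝓓^{1}(Ω, E N)) (hφ : ∀ x, ‖φ x‖ ≤ 1) :
    ∫ x in (Ω : Set (E N)), a x * divergence φ x ≤ c := by
  have := (le_iSup (fun φ : {φ : 𝓓^{1}(Ω, E N) // ∀ x, ‖φ x‖ ≤ 1} =>
    ENNReal.ofReal (∫ x in (Ω : Set (E N)), a x * divergence φ.1 x)) ⟨φ, hφ⟩).trans h
  exact (ENNReal.ofReal_le_ofReal_iff hc).1 this

lemma integrable_mul_divergence (a : L2 Ω) (φ : 𝓓^{1}(Ω, E N)) :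
    Integrable (fun x => a x * divergence φ x) (vol Ω) := by
  have hcont : Continuous (divergence φ) := by
    refine continuous_finsetSum _ fun i _ => ?_
    have h1 : Continuous (fderiv ℝ φ) := φ.contDiff.continuous_fderiv (by simp)
    exact (EuclideanSpace.proj (𝕜 := ℝ) i).continuous.comp (h1.clm_apply continuous_const)
  have hsupp : HasCompactSupport (divergence φ) :=
    (φ.hasCompactSupport.fderiv (𝕜 := ℝ)).comp_left
      (g := fun L : E N →L[ℝ] E N => ∑ i : Fin N, (L (EuclideanSpace.single i 1)) i) (by simp)
  exact MemLp.integrable_mul (p := 2) (q := 2) (Lp.memLp a) ((hcont.memLp_of_hasCompactSupport hsupp).restrict _)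

/-- For each test field the integral is linear in the function, so a bound at both ends of a segment
holds along it. -/
lemma totalVariation_combo_le {a b : L2 Ω} {c : ℝ} (hc : 0 ≤ c)
    (ha : totalVariation a ≤ ENNReal.ofReal c) (hb : totalVariation b ≤ ENNReal.ofReal c) {θ : ℝ}
    (hθ : θ ∈ Set.Icc (0 : ℝ) 1) : totalVariation (a + θ • (b - a)) ≤ ENNReal.ofReal c := by
  refine iSup_le fun φ => ENNReal.ofReal_le_ofReal ?_
  have h1 := integral_mul_divergence_le hc ha φ.1 φ.2
  have h2 := integral_mul_divergence_le hc hb φ.1 φ.2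
  have h3 : ∫ x in (Ω : Set (E N)), (a + θ • (b - a) : L2 Ω) x * divergence φ.1 x =
      (1 - θ) * (∫ x in (Ω : Set (E N)), a x * divergence φ.1 x) +
        θ * ∫ x in (Ω : Set (E N)), b x * divergence φ.1 x := by
    rw [← integral_const_mul, ← integral_const_mul,
      ← integral_add ((integrable_mul_divergence a φ.1).const_mul _)
        ((integrable_mul_divergence b φ.1).const_mul _)]
    refine integral_congr_ae ?_
    filter_upwards [Lp.coeFn_add a (θ • (b - a)), Lp.coeFn_smul θ (b - a), Lp.coeFn_sub b a]
      with x e1 e2 e3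
    rw [e1, Pi.add_apply, e2, Pi.smul_apply, e3, Pi.sub_apply, smul_eq_mul]
    ring
  rw [h3]
  have h4 := mul_le_mul_of_nonneg_left h1 (sub_nonneg.2 hθ.2)
  have h5 := mul_le_mul_of_nonneg_left h2 hθ.1
  linarith

/-- The set of admissible controls is convex. -/
lemma segment_mem_admissible (hP : P.Standing) {A B : L2Mat Ω} (hA : A ∈ P.Admissible)
    (hB : B ∈ P.Admissible) {θ : ℝ} (hθ : θ ∈ Set.Icc (0 : ℝ) 1) :
    Data.segment A B θ ∈ P.Admissible := by
  refine ⟨⟨fun i j hij => ?_, ?_⟩, fun i j hij => ?_, ?_⟩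
  · rw [symPart_segment]
    exact totalVariation_combo_le hP.c_pos.le (hA.1.1 i j hij) (hB.1.1 i j hij) hθ
  · rw [symPart_segment]
    filter_upwards [app_segment_ae (symPart A) (symPart B) θ, hA.1.2, hB.1.2] with x h1 h2 h3 ξ
    have e : ⟪app (Data.segment (symPart A) (symPart B) θ) x ξ, ξ⟫ =
        (1 - θ) * ⟪app (symPart A) x ξ, ξ⟫ + θ * ⟪app (symPart B) x ξ, ξ⟫ := by
      rw [h1, inner_add_left, real_inner_smul_left, inner_sub_left]; ring
    have h4 := sub_nonneg.2 hθ.2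
    have h5 := hθ.1
    rw [e]
    constructor
    · linarith [mul_le_mul_of_nonneg_left (h2 ξ).1 h4, mul_le_mul_of_nonneg_left (h3 ξ).1 h5]
    · linarith [mul_le_mul_of_nonneg_left (h2 ξ).2 h4, mul_le_mul_of_nonneg_left (h3 ξ).2 h5]
  · rw [skewPart_segment]
    have e : Data.segment (skewPart A) (skewPart B) θ i j =
        skewPart A i j + θ • (skewPart B i j - skewPart A i j) := rfl
    rw [e]
    filter_upwards [Lp.coeFn_add (skewPart A i j) (θ • (skewPart B i j - skewPart A i j)),
      Lp.coeFn_smul θ (skewPart B i j - skewPart A i j),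
      Lp.coeFn_sub (skewPart B i j) (skewPart A i j), hA.2.1 i j hij, hB.2.1 i j hij]
      with x e1 e2 e3 h1 h2
    rw [e1, Pi.add_apply, e2, Pi.smul_apply, e3, Pi.sub_apply, smul_eq_mul]
    have h4 := sub_nonneg.2 hθ.2
    rw [abs_le] at h1 h2 ⊢
    constructor
    · linarith [mul_le_mul_of_nonneg_left h1.1 h4, mul_le_mul_of_nonneg_left h2.1 hθ.1]
    · linarith [mul_le_mul_of_nonneg_left h1.2 h4, mul_le_mul_of_nonneg_left h2.2 hθ.1]
  · rw [skewPart_segment]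
    have e : Data.segment (skewPart A) (skewPart B) θ =
        (1 - θ) • skewPart A + θ • skewPart B := by
      rw [Data.segment]; module
    rw [e]
    exact hP.Q_convex hA.2.2 hB.2.2 (sub_nonneg.2 hθ.2) hθ.1 (by ring)

end Controls

/-! ### Abstract Hilbert space identities and limits. -/

section WeakConvergence

variable {H W : Type*} [NormedAddCommGroup H] [InnerProductSpace ℝ H]
  [NormedAddCommGroup W] [InnerProductSpace ℝ W]

/-- The inner product of a strongly convergent sequence with one converging weakly to zero. -/
lemma tendsto_inner_of_weak {T U : H →L[ℝ] W} {w n : ℕ → H} {w₀ : H}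
    (hw : Tendsto w atTop (𝓝 w₀))
    (hn : ∀ ℓ : StrongDual ℝ H, Tendsto (fun k => ℓ (n k)) atTop (𝓝 0)) :
    Tendsto (fun k => ⟪T (w k), U (n k)⟫) atTop (𝓝 0) := by
  -- A weakly null sequence is bounded, by uniform boundedness on the dual space. This controls the
  -- error from replacing `w k` by its limit `w₀`.
  obtain ⟨C, hC⟩ := banach_steinhaus (g := fun k => NormedSpace.inclusionInDoubleDual ℝ H (n k))
    fun ℓ => by
      obtain ⟨C, hC⟩ := (hn ℓ).norm.bddAbove_range
      exact ⟨C, fun k => hC ⟨k, rfl⟩⟩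
  have hC' : ∀ k, ‖n k‖ ≤ C := fun k => by
    have := hC k
    rwa [← (NormedSpace.inclusionInDoubleDualLi ℝ (E := H)).norm_map (n k)]
  have h1 : Tendsto (fun k => ⟪T w₀, U (n k)⟫) atTop (𝓝 0) :=
    hn ((innerSL ℝ (T w₀)).comp U)
  have h2 : Tendsto (fun k => ⟪T (w k - w₀), U (n k)⟫) atTop (𝓝 0) := by
    have hw' : Tendsto (fun k => ‖T‖ * ‖w k - w₀‖ * (‖U‖ * C)) atTop (𝓝 0) := by
      have : Tendsto (fun k => ‖w k - w₀‖) atTop (𝓝 0) := by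
        simpa using (hw.sub_const w₀).norm
      simpa using (this.const_mul ‖T‖).mul_const (‖U‖ * C)
    refine squeeze_zero_norm (fun k => ?_) hw'
    refine (norm_inner_le_norm _ _).trans (mul_le_mul (T.le_opNorm _) ?_ (norm_nonneg _)
      (by positivity))
    exact (U.le_opNorm _).trans (mul_le_mul_of_nonneg_left (hC' k) (norm_nonneg _))
  have h3 := h1.add h2
  rw [add_zero] at h3
  refine h3.congr fun k => ?_
  rw [map_sub, inner_sub_left]
  ring

/-- A quadratic functional differs between two points by its derivative at their midpoint. -/
lemma inner_midpoint_sub (T : W →L[ℝ] W) (hs : ∀ u v : W, ⟪T u, v⟫ = ⟪u, T v⟫) (a b : W) :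
    2 * ⟪b - a, T (a + (1 / 2 : ℝ) • (b - a))⟫ = ⟪b, T b⟫ - ⟪a, T a⟫ := by
  have h : ⟪b, T a⟫ = ⟪a, T b⟫ := by rw [← hs, real_inner_comm]
  simp only [map_add, map_smul, map_sub, inner_add_right, inner_sub_left, inner_sub_right,
    real_inner_smul_right, h]
  ring

/-- Here `u₀`, `u`, `p` stand for the gradients of `y₀`, `y_θ`, `ψ`, `κ₀` and `κ₁` for the two skew
parts applied to `∇ψ`, and `F` for `⟨f, ψ⟩`, which both state equations evaluate. The midpoint
identity lets `hadj` convert the cost increment into a pairing with `u - u₀`; equating the two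
values of `F` removes `u`. Everything left is `θ` times the claim, without remainder. -/
lemma nonneg_of_cost_le {V : Type*} [NormedAddCommGroup V] [InnerProductSpace ℝ V]
    {T₀ T₁ : W →L[ℝ] W} (hs₀ : ∀ u v : W, ⟪T₀ u, v⟫ = ⟪u, T₀ v⟫)
    (hs₁ : ∀ u v : W, ⟪T₁ u, v⟫ = ⟪u, T₁ v⟫) {u₀ u p κ₀ κ₁ : W} {w₀ w d : V} {lam θ F : ℝ}
    (hlam : 0 < lam) (hθ : 0 < θ)
    (hcost : ‖w₀ - d‖ ^ 2 + ⟪u₀, T₀ u₀⟫ ≤ ‖w - d‖ ^ 2 + ⟪u, (T₀ + θ • (T₁ - T₀)) u⟫)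
    (hadj : ⟪u - u₀, (T₀ + θ • (T₁ - T₀)) p - (κ₀ + θ • (κ₁ - κ₀))⟫ =
      -2 * lam * ⟪w₀ + (1 / 2 : ℝ) • (w - w₀) - d, w - w₀⟫ -
        2 * lam * ⟪u - u₀, (T₀ + θ • (T₁ - T₀)) (u₀ + (1 / 2 : ℝ) • (u - u₀))⟫)
    (hF₀ : F = ⟪p, T₀ u₀⟫ + -⟪u₀, κ₀⟫)
    (hF : F = ⟪p, (T₀ + θ • (T₁ - T₀)) u⟫ + -⟪u, κ₀ + θ • (κ₁ - κ₀)⟫) :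
    0 ≤ lam * ⟪u₀, T₁ u₀ - T₀ u₀⟫ + (⟪u₀, T₁ p - T₀ p⟫ + -⟪u₀, κ₁⟫ - -⟪u₀, κ₀⟫) := by
  have hTa : ∀ v, (T₀ + θ • (T₁ - T₀)) v = T₀ v + θ • (T₁ v - T₀ v) := fun v => rfl
  have hs : ∀ u v : W, ⟪(T₀ + θ • (T₁ - T₀)) u, v⟫ = ⟪u, (T₀ + θ • (T₁ - T₀)) v⟫ := fun u v => by
    simp only [hTa, inner_add_left, inner_add_right, real_inner_smul_left, real_inner_smul_right,
      inner_sub_left, inner_sub_right, hs₀, hs₁]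
  have c1 : 2 * ⟪w₀ + (1 / 2 : ℝ) • (w - w₀) - d, w - w₀⟫ = ‖w - d‖ ^ 2 - ‖w₀ - d‖ ^ 2 := by
    have h := inner_midpoint_sub (ContinuousLinearMap.id ℝ V) (fun _ _ => rfl) (w₀ - d) (w - d)
    simp only [ContinuousLinearMap.id_apply, sub_sub_sub_cancel_right,
      real_inner_self_eq_norm_sq] at h
    rw [← h, real_inner_comm]
    congr 2
    abel
  have c2 := inner_midpoint_sub _ hs u₀ u
  have c3 : ⟪p, T₀ u₀⟫ = ⟪u₀, T₀ p⟫ := by rw [← hs₀, real_inner_comm]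
  have c4 : ⟪p, (T₀ + θ • (T₁ - T₀)) u⟫ = ⟪u, (T₀ + θ • (T₁ - T₀)) p⟫ := by
    rw [← hs, real_inner_comm]
  have c5 : ⟪u₀, (T₀ + θ • (T₁ - T₀)) p⟫ = ⟪u₀, T₀ p⟫ + θ * ⟪u₀, T₁ p - T₀ p⟫ := by
    rw [hTa, inner_add_right, real_inner_smul_right]
  have c6 : ⟪u₀, (T₀ + θ • (T₁ - T₀)) u₀⟫ = ⟪u₀, T₀ u₀⟫ + θ * ⟪u₀, T₁ u₀ - T₀ u₀⟫ := by
    rw [hTa, inner_add_right, real_inner_smul_right]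
  have c7 : ⟪u₀, κ₀ + θ • (κ₁ - κ₀)⟫ = ⟪u₀, κ₀⟫ + θ * (⟪u₀, κ₁⟫ - ⟪u₀, κ₀⟫) := by
    rw [inner_add_right, real_inner_smul_right, inner_sub_right]
  rw [inner_sub_left, inner_sub_right u, inner_sub_right u₀] at hadj
  rw [c4] at hF
  rw [c3] at hF₀
  refine nonneg_of_mul_nonneg_right (a := θ) ?_ hθ
  have h1 := mul_le_mul_of_nonneg_left hcost hlam.le
  linear_combination h1 + hadj - lam * c1 - lam * c2 - hF₀ + hF + c5 + lam * c6 - c7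

/-- Here `p` is `∇ψ₀` and `g` is `∇(ψ - ψ₀)`. The hypothesis `hz` expresses skewness: it trades the
flux `κ` of the moving adjoint state for the fluxes `κ₀`, `κ₁` of the fixed one, so no uniform bound
on `κ` is needed. -/
lemma adjoint_difference {V : Type*} [NormedAddCommGroup V] [InnerProductSpace ℝ V]
    {T₀ T₁ : W →L[ℝ] W} {g p κ κ₀ κ₁ u₀ m : W} {x w₀ r d : V} {lam θ : ℝ}
    (h1 : ⟪g, (T₀ + θ • (T₁ - T₀)) (p + g) - κ⟫ = -2 * lam * ⟪w₀ + r - d, x⟫ -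
      2 * lam * ⟪g, (T₀ + θ • (T₁ - T₀)) (u₀ + m)⟫)
    (h0 : ⟪g, T₀ p - κ₀⟫ = -2 * lam * ⟪w₀ - d, x⟫ - 2 * lam * ⟪g, T₀ u₀⟫)
    (hz : ⟪g, κ - (κ₀ + θ • (κ₁ - κ₀))⟫ = 0) :
    ⟪g, T₀ g⟫ = -2 * lam * (⟪x, r⟫ + ⟪g, T₀ m⟫) +
      θ * (⟪g, (κ₁ - κ₀) - (T₁ - T₀) p⟫ - 2 * lam * (⟪g, (T₁ - T₀) m⟫ + ⟪g, (T₁ - T₀) u₀⟫) -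
        ⟪g, (T₁ - T₀) g⟫) := by
  have hTa : ∀ v, (T₀ + θ • (T₁ - T₀)) v = T₀ v + θ • (T₁ - T₀) v := fun v => rfl
  have hr : ⟪w₀ + r - d, x⟫ = ⟪w₀ - d, x⟫ + ⟪x, r⟫ := by
    rw [real_inner_comm r x, ← inner_add_left, add_sub_right_comm]
  rw [hr] at h1
  simp only [hTa, map_add, inner_add_right, inner_sub_right, real_inner_smul_right] at h1 h0 hz ⊢
  linear_combination h1 - h0 + hz

/-- If the energies `⟪G wₖ, T₀ G wₖ⟫` of a convergent sequence are expressed through a sequence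
converging weakly to zero and terms of order `τₖ → 0`, then the energy of the limit vanishes. -/
lemma energy_limit_eq_zero {V : Type*} [NormedAddCommGroup V] [InnerProductSpace ℝ V]
    (G : H →L[ℝ] W) (J : H →L[ℝ] V) {T₀ D : W →L[ℝ] W} {w n : ℕ → H} {w₀ : H} {τ : ℕ → ℝ}
    {R u₀ : W} {lam : ℝ} (hw : Tendsto w atTop (𝓝 w₀))
    (hn : ∀ ℓ : StrongDual ℝ H, Tendsto (fun k => ℓ (n k)) atTop (𝓝 0))
    (hτ : Tendsto τ atTop (𝓝 0))
    (hid : ∀ k, ⟪G (w k), T₀ (G (w k))⟫ =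
      -2 * lam * (⟪J (w k), J (n k)⟫ + ⟪G (w k), T₀ (G (n k))⟫) +
      τ k * (⟪G (w k), R⟫ - 2 * lam * (⟪G (w k), D (G (n k))⟫ + ⟪G (w k), D u₀⟫) -
        ⟪G (w k), D (G (w k))⟫)) :
    ⟪G w₀, T₀ (G w₀)⟫ = 0 := by
  have hgw : Tendsto (fun k => G (w k)) atTop (𝓝 (G w₀)) := (G.continuous.tendsto _).comp hw
  have t0 : Tendsto (fun k => ⟪G (w k), T₀ (G (w k))⟫) atTop (𝓝 ⟪G w₀, T₀ (G w₀)⟫) :=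
    hgw.inner ((T₀.continuous.tendsto _).comp hgw)
  have t1 := tendsto_inner_of_weak (T := J) (U := J) hw hn
  have t2 := tendsto_inner_of_weak (T := G) (U := T₀.comp G) hw hn
  have t3 := tendsto_inner_of_weak (T := G) (U := D.comp G) hw hn
  have t4 : Tendsto (fun k => ⟪G (w k), R⟫) atTop (𝓝 ⟪G w₀, R⟫) := hgw.inner tendsto_const_nhds
  have t5 : Tendsto (fun k => ⟪G (w k), D u₀⟫) atTop (𝓝 ⟪G w₀, D u₀⟫) :=
    hgw.inner tendsto_const_nhds
  have t6 : Tendsto (fun k => ⟪G (w k), D (G (w k))⟫) atTop (𝓝 ⟪G w₀, D (G w₀)⟫) :=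
    hgw.inner ((D.continuous.tendsto _).comp hgw)
  have t7 := ((t1.add t2).const_mul (-2 * lam)).add
    (hτ.mul ((t4.sub ((t3.add t5).const_mul (2 * lam))).sub t6))
  rw [zero_mul, add_zero, add_zero, mul_zero] at t7
  exact tendsto_nhds_unique (t0.congr hid) t7

end WeakConvergence

/-! ### State and adjoint equations on `H¹₀`, and the limit of the quasi-adjoint states. -/

section Optimality

variable {N : ℕ} {Ω : Opens (E N)} {P : Data Ω}

/-- The adjoint equation, tested with arbitrary elements of `H¹₀(Ω)`. -/
lemma adjoint_eq {A : L2Mat Ω} {T : L2Vec Ω →L[ℝ] L2Vec Ω}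
    (hT : ∀ u : L2Vec Ω, T u =ᵐ[vol Ω] fun x => app (symPart A) x (u x)) {ψ z : H10 Ω}
    {κ : L2Vec Ω} (hκ : κ =ᵐ[vol Ω] fun x => app (skewPart A) x (grad ψ x)) {lam : ℝ}
    (h : P.IsAdjointSolution lam A z ψ) (v : H10 Ω) :
    ⟪grad v, T (grad ψ) - κ⟫ =
      -2 * lam * ⟪val z - P.yd, val v⟫ - 2 * lam * ⟪grad v, T (grad z)⟫ := by
  -- Both sides are continuous in `v` because the skew flux `κ` is in `L²`.
  have key : (fun v : H10 Ω => ⟪gradL Ω v, T (grad ψ) - κ⟫) = fun v =>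
      -2 * lam * ⟪val z - P.yd, valL Ω v⟫ - 2 * lam * ⟪gradL Ω v, T (grad z)⟫ := by
    refine denseRange_ofTest.equalizer (by fun_prop) (by fun_prop) (funext fun φ => ?_)
    simp only [Function.comp_apply, gradL_apply, valL_apply]
    have h' := h φ
    have e1 : ∫ x in (Ω : Set (E N)), ⟪gradient φ x, app Aᵀ x (grad ψ x)⟫ =
        ⟪grad (ofTest φ), T (grad ψ) - κ⟫ := by
      rw [L2.inner_def]
      refine integral_congr_ae ?_
      filter_upwards [grad_ofTest_ae φ, hT (grad ψ), hκ, Lp.coeFn_sub (T (grad ψ)) κ,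
        app_sub_left_ae (symPart A) (skewPart A)] with x h1 h2 h3 h4 h5
      rw [h1, h4, Pi.sub_apply, h2, h3, ← h5, symPart_sub_skewPart]
    have e2 : ∫ x in (Ω : Set (E N)), (val z x - P.yd x) * φ x =
        ⟪val z - P.yd, val (ofTest φ)⟫ := by
      rw [L2.inner_def]
      refine integral_congr_ae ?_
      filter_upwards [val_ofTest_ae φ, Lp.coeFn_sub (val z) P.yd] with x h1 h2
      rw [h1, h2, Pi.sub_apply]
      simp [mul_comm]
    have e3 : ∫ x in (Ω : Set (E N)), ⟪gradient φ x, app (symPart A) x (grad z x)⟫ =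
        ⟪grad (ofTest φ), T (grad z)⟫ := by
      rw [L2.inner_def]
      refine integral_congr_ae ?_
      filter_upwards [grad_ofTest_ae φ, hT (grad z)] with x h1 h2
      rw [h1, h2]
    rw [← e1, ← e2, ← e3]
    exact h'
  exact congrFun key v

/-- The state equation, tested with arbitrary elements of `H¹₀(Ω)`. -/
lemma state_eq {A : L2Mat Ω} {T : L2Vec Ω →L[ℝ] L2Vec Ω}
    (hT : ∀ u : L2Vec Ω, T u =ᵐ[vol Ω] fun x => app (symPart A) x (u x)) {y : H10 Ω}
    (hy : y ∈ D A) (h : P.IsWeakSolution A y) (v : H10 Ω) :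
    P.f v = ⟪grad v, T (grad y)⟫ + bracket A y v := by
  obtain ⟨ℓ, hℓ, hb⟩ := exists_dual_eq_bracket hy
  -- For the state the skew flux need not be in `L²`; the extension `ℓ` granted by `y ∈ D A` takes
  -- its place.
  have key : (fun v : H10 Ω => P.f v) = fun v => ⟪gradL Ω v, T (grad y)⟫ + ℓ v := by
    refine denseRange_ofTest.equalizer (by fun_prop) (by fun_prop) (funext fun φ => ?_)
    simp only [Function.comp_apply, gradL_apply]
    rw [← h φ, hℓ, skewForm, L2.inner_def]
    have i1 : Integrable (fun x => ⟪gradient φ x, app (skewPart A) x (grad y x)⟫) (vol Ω) := by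
      refine (integrable_inner_app_gradient (skewPart A) (grad y) φ).neg.congr ?_
      filter_upwards [(isSkew_skewPart A).inner_app] with x hx
      rw [Pi.neg_apply, hx, neg_neg, real_inner_comm]
    rw [← integral_add (L2.integrable_inner _ _) i1]
    refine integral_congr_ae ?_
    filter_upwards [grad_ofTest_ae φ, hT (grad y), app_add_left_ae (symPart A) (skewPart A)]
      with x h1 h2 h3
    rw [h1, h2, ← inner_add_right, ← h3, symPart_add_skewPart]
  rw [hb]
  exact congrFun key v

lemma cost_eq {A : L2Mat Ω} {T : L2Vec Ω →L[ℝ] L2Vec Ω}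
    (hT : ∀ u : L2Vec Ω, T u =ᵐ[vol Ω] fun x => app (symPart A) x (u x)) (y : H10 Ω) :
    P.cost (A, y) = ‖val y - P.yd‖ ^ 2 + ⟪grad y, T (grad y)⟫ := by
  rw [Data.cost, L2.inner_def]
  congr 1
  refine integral_congr_ae ?_
  filter_upwards [hT (grad y)] with x hx
  rw [hx]

lemma bracket_eq_neg_inner (hP : P.Standing) (hN : 2 ≤ N)
    (hbdd : Bornology.IsBounded (Ω : Set (E N))) (hLip : HasLipschitzBoundary Ω) {A : L2Mat Ω}
    (hA : A ∈ P.Admissible) {y ψ : H10 Ω} (hy : y ∈ D A) (hψ : P.Regular ψ) {κ : L2Vec Ω}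
    (hκ : κ =ᵐ[vol Ω] fun x => app (skewPart A) x (grad ψ x)) :
    bracket A y ψ = -⟪grad y, κ⟫ := by
  rw [bracket_eq_neg_integral hP hN hbdd hLip hA hy hψ, L2.inner_def]
  congr 1
  refine integral_congr_ae ?_
  filter_upwards [hκ] with x hx
  rw [hx]

lemma inner_skew_self {K : L2Mat Ω} (hK : IsSkew K) {u κ : L2Vec Ω}
    (hκ : κ =ᵐ[vol Ω] fun x => app K x (u x)) : ⟪u, κ⟫ = 0 := by
  rw [L2.inner_def]
  refine integral_eq_zero_of_ae ?_
  filter_upwards [hκ, hK.inner_app] with x h1 h2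
  have h3 := h2 (u x) (u x)
  rw [real_inner_comm (u x)] at h3
  rw [h1, Pi.zero_apply]
  linarith

lemma segment_ae {B₀ B₁ : L2Mat Ω} {u f₀ f₁ : L2Vec Ω}
    (h₀ : f₀ =ᵐ[vol Ω] fun x => app B₀ x (u x)) (h₁ : f₁ =ᵐ[vol Ω] fun x => app B₁ x (u x))
    (θ : ℝ) : f₀ + θ • (f₁ - f₀) =ᵐ[vol Ω] fun x => app (Data.segment B₀ B₁ θ) x (u x) := by
  filter_upwards [app_segment_ae B₀ B₁ θ, h₀, h₁, Lp.coeFn_add f₀ (θ • (f₁ - f₀)),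
    Lp.coeFn_smul θ (f₁ - f₀), Lp.coeFn_sub f₁ f₀] with x h1 h2 h3 h4 h5 h6
  rw [h4, Pi.add_apply, h5, Pi.smul_apply, h6, Pi.sub_apply, h1, h2, h3]

lemma symPart_segment_apply_ae {A₀ A₁ : L2Mat Ω} {T₀ T₁ : L2Vec Ω →L[ℝ] L2Vec Ω}
    (hT₀ : ∀ u : L2Vec Ω, T₀ u =ᵐ[vol Ω] fun x => app (symPart A₀) x (u x))
    (hT₁ : ∀ u : L2Vec Ω, T₁ u =ᵐ[vol Ω] fun x => app (symPart A₁) x (u x)) (θ : ℝ)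
    (u : L2Vec Ω) : (T₀ + θ • (T₁ - T₀)) u =ᵐ[vol Ω]
      fun x => app (symPart (Data.segment A₀ A₁ θ)) x (u x) := by
  rw [symPart_segment]
  exact segment_ae (hT₀ u) (hT₁ u) θ

lemma skewPart_segment_ae {A₀ A₁ : L2Mat Ω} {u κ₀ κ₁ : L2Vec Ω}
    (h₀ : κ₀ =ᵐ[vol Ω] fun x => app (skewPart A₀) x (u x))
    (h₁ : κ₁ =ᵐ[vol Ω] fun x => app (skewPart A₁) x (u x)) (θ : ℝ) :
    κ₀ + θ • (κ₁ - κ₀) =ᵐ[vol Ω]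
      fun x => app (skewPart (Data.segment A₀ A₁ θ)) x (u x) := by
  rw [skewPart_segment]
  exact segment_ae h₀ h₁ θ

/-- Convexity turns the optimality of `(A₀, y₀)` against `(A_θ, y_θ)` into an inequality that is
linear in the adjoint state at the midpoint of the two states. -/
lemma optimality_inequality (hP : P.Standing) (hN : 2 ≤ N)
    (hbdd : Bornology.IsBounded (Ω : Set (E N))) (hLip : HasLipschitzBoundary Ω)
    {A₀ A : L2Mat Ω} {y₀ yθ ψ : H10 Ω} {lam θ : ℝ} (hlam : 0 < lam)
    (hopt : P.IsOptimal A₀ y₀) (hA : A ∈ P.Admissible) (hy₀A : y₀ ∈ D A) (hθ : θ ∈ Set.Ioc (0 : ℝ) 1)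
    (hyθ : yθ ∈ D (Data.segment A₀ A θ)) (hsol : P.IsWeakSolution (Data.segment A₀ A θ) yθ)
    (hψ : P.Regular ψ) (hadj : P.IsQuasiAdjoint lam (Data.segment A₀ A θ) y₀ yθ (1 / 2) ψ)
    {T₀ T₁ : L2Vec Ω →L[ℝ] L2Vec Ω}
    (hT₀ : ∀ u : L2Vec Ω, T₀ u =ᵐ[vol Ω] fun x => app (symPart A₀) x (u x))
    (hT₁ : ∀ u : L2Vec Ω, T₁ u =ᵐ[vol Ω] fun x => app (symPart A) x (u x))
    (hs₀ : ∀ u v : L2Vec Ω, ⟪T₀ u, v⟫ = ⟪u, T₀ v⟫) (hs₁ : ∀ u v : L2Vec Ω, ⟪T₁ u, v⟫ = ⟪u, T₁ v⟫) :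
    0 ≤ lam * ⟪grad y₀, T₁ (grad y₀) - T₀ (grad y₀)⟫ +
      (⟪grad y₀, T₁ (grad ψ) - T₀ (grad ψ)⟫ + bracket A y₀ ψ - bracket A₀ y₀ ψ) := by
  have hθ' : θ ∈ Set.Icc (0 : ℝ) 1 := ⟨hθ.1.le, hθ.2⟩
  obtain ⟨⟨hA₀, hy₀, hsol₀⟩, hmin⟩ := hopt
  have hAθ := segment_mem_admissible hP hA₀ hA hθ'
  have hT := symPart_segment_apply_ae hT₀ hT₁ θ
  have hκ₀ := (memLp_skewPart_app hP hA₀ hψ).coeFn_toLp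
  have hκ₁ := (memLp_skewPart_app hP hA hψ).coeFn_toLp
  have hκ := skewPart_segment_ae hκ₀ hκ₁ θ
  have hcost : P.cost (A₀, y₀) ≤ P.cost (Data.segment A₀ A θ, yθ) := hmin ⟨hAθ, hyθ, hsol⟩
  rw [cost_eq hT₀, cost_eq hT] at hcost
  have a1 := adjoint_eq hT hκ hadj (yθ - y₀)
  have s0 := state_eq hT₀ hy₀ hsol₀ ψ
  have s1 := state_eq hT hyθ hsol ψ
  have b0 := bracket_eq_neg_inner hP hN hbdd hLip hA₀ hy₀ hψ hκ₀
  have b1 := bracket_eq_neg_inner hP hN hbdd hLip hA hy₀A hψ hκ₁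
  have bθ := bracket_eq_neg_inner hP hN hbdd hLip hAθ hyθ hψ hκ
  have g1 : grad (yθ - y₀) = grad yθ - grad y₀ := (gradL Ω).map_sub _ _
  have v1 : val (yθ - y₀) = val yθ - val y₀ := (valL Ω).map_sub _ _
  have g2 : grad (y₀ + (1 / 2 : ℝ) • (yθ - y₀)) =
      grad y₀ + (1 / 2 : ℝ) • (grad yθ - grad y₀) := by
    simp only [← gradL_apply, map_add, map_smul, map_sub]
  have v2 : val (y₀ + (1 / 2 : ℝ) • (yθ - y₀)) = val y₀ + (1 / 2 : ℝ) • (val yθ - val y₀) := by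
    simp only [← valL_apply, map_add, map_smul, map_sub]
  rw [g1, v1, g2, v2] at a1
  rw [b0, b1]
  rw [b0] at s0
  rw [bθ] at s1
  exact nonneg_of_cost_le hs₀ hs₁ hlam hθ.1 hcost a1 s0 s1

/-- The energy of the difference of two adjoint states for neighbouring controls. -/
lemma energy_adjoint_difference (hP : P.Standing) {A₀ A : L2Mat Ω} (hA₀ : A₀ ∈ P.Admissible)
    (hA : A ∈ P.Admissible) {y₀ n ψ₀ ψ : H10 Ω} {lam τ : ℝ} (hτ : τ ∈ Set.Icc (0 : ℝ) 1)
    (hadj₀ : P.IsAdjointSolution lam A₀ y₀ ψ₀) (hψ : P.Regular ψ)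
    (hadj : P.IsAdjointSolution lam (Data.segment A₀ A τ) (y₀ + n) ψ)
    {T₀ T₁ : L2Vec Ω →L[ℝ] L2Vec Ω}
    (hT₀ : ∀ u : L2Vec Ω, T₀ u =ᵐ[vol Ω] fun x => app (symPart A₀) x (u x))
    (hT₁ : ∀ u : L2Vec Ω, T₁ u =ᵐ[vol Ω] fun x => app (symPart A) x (u x)) {κ₀ κ₁ : L2Vec Ω}
    (hκ₀ : κ₀ =ᵐ[vol Ω] fun x => app (skewPart A₀) x (grad ψ₀ x))
    (hκ₁ : κ₁ =ᵐ[vol Ω] fun x => app (skewPart A) x (grad ψ₀ x)) :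
    ⟪grad (ψ - ψ₀), T₀ (grad (ψ - ψ₀))⟫ =
      -2 * lam * (⟪val (ψ - ψ₀), val n⟫ + ⟪grad (ψ - ψ₀), T₀ (grad n)⟫) +
      τ * (⟪grad (ψ - ψ₀), (κ₁ - κ₀) - (T₁ - T₀) (grad ψ₀)⟫ -
        2 * lam * (⟪grad (ψ - ψ₀), (T₁ - T₀) (grad n)⟫ +
          ⟪grad (ψ - ψ₀), (T₁ - T₀) (grad y₀)⟫) -
        ⟪grad (ψ - ψ₀), (T₁ - T₀) (grad (ψ - ψ₀))⟫) := by
  have hAθ := segment_mem_admissible hP hA₀ hA hτ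
  obtain ⟨κ, hκ⟩ : ∃ κ : L2Vec Ω,
      κ =ᵐ[vol Ω] fun x => app (skewPart (Data.segment A₀ A τ)) x (grad ψ x) :=
    ⟨_, (memLp_skewPart_app hP hAθ hψ).coeFn_toLp⟩
  have a1 := adjoint_eq (symPart_segment_apply_ae hT₀ hT₁ τ) hκ hadj (ψ - ψ₀)
  have a0 := adjoint_eq hT₀ hκ₀ hadj₀ (ψ - ψ₀)
  have hz : ⟪grad (ψ - ψ₀), κ - (κ₀ + τ • (κ₁ - κ₀))⟫ = 0 := by
    refine inner_skew_self (isSkew_skewPart (Data.segment A₀ A τ)) ?_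
    filter_upwards [hκ, skewPart_segment_ae hκ₀ hκ₁ τ, grad_sub_ae ψ ψ₀,
      Lp.coeFn_sub κ (κ₀ + τ • (κ₁ - κ₀))] with x h1 h2 h3 h4
    rw [h4, Pi.sub_apply, h1, h2, h3, app_sub_right]
  have g0 : grad (ψ - ψ₀) = grad ψ - grad ψ₀ := (gradL Ω).map_sub _ _
  have g1 : grad ψ = grad ψ₀ + grad (ψ - ψ₀) := by rw [g0, add_sub_cancel]
  have g2 : grad (y₀ + n) = grad y₀ + grad n := (gradL Ω).map_add _ _
  have v2 : val (y₀ + n) = val y₀ + val n := (valL Ω).map_add _ _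
  rw [g1, g2, v2] at a1
  exact adjoint_difference a1 a0 hz

/-- Quasi-adjoint states along a segment of controls converge to the regular adjoint state. -/
lemma quasiAdjoint_limit_eq (hP : P.Standing) (hN : 2 ≤ N)
    (hbdd : Bornology.IsBounded (Ω : Set (E N))) {A₀ A : L2Mat Ω} (hA₀ : A₀ ∈ P.Admissible)
    (hA : A ∈ P.Admissible) {y₀ ψ₀ ψlim : H10 Ω} {y ψ : ℕ → H10 Ω} {lam : ℝ} {τ : ℕ → ℝ}
    (hτ : ∀ k, τ k ∈ Set.Icc (0 : ℝ) 1) (hτ0 : Tendsto τ atTop (𝓝 0))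
    (hy : ∀ ℓ : StrongDual ℝ (H10 Ω), Tendsto (fun k => ℓ (y k)) atTop (𝓝 (ℓ y₀)))
    (hψ₀ : P.Regular ψ₀) (hadj₀ : P.IsAdjointSolution lam A₀ y₀ ψ₀)
    (hψ : ∀ k, P.Regular (ψ k))
    (hadj : ∀ k, P.IsQuasiAdjoint lam (Data.segment A₀ A (τ k)) y₀ (y k) (1 / 2) (ψ k))
    (hlim : Tendsto ψ atTop (𝓝 ψlim)) {T₀ T₁ : L2Vec Ω →L[ℝ] L2Vec Ω}
    (hT₀ : ∀ u : L2Vec Ω, T₀ u =ᵐ[vol Ω] fun x => app (symPart A₀) x (u x))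
    (hT₁ : ∀ u : L2Vec Ω, T₁ u =ᵐ[vol Ω] fun x => app (symPart A) x (u x))
    (hpos : ∀ u : L2Vec Ω, P.α * ‖u‖ ^ 2 ≤ ⟪T₀ u, u⟫) : ψlim = ψ₀ := by
  obtain ⟨κ₀, hκ₀⟩ : ∃ κ : L2Vec Ω, κ =ᵐ[vol Ω] fun x => app (skewPart A₀) x (grad ψ₀ x) :=
    ⟨_, (memLp_skewPart_app hP hA₀ hψ₀).coeFn_toLp⟩
  obtain ⟨κ₁, hκ₁⟩ : ∃ κ : L2Vec Ω, κ =ᵐ[vol Ω] fun x => app (skewPart A) x (grad ψ₀ x) :=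
    ⟨_, (memLp_skewPart_app hP hA hψ₀).coeFn_toLp⟩
  have hid := fun k => energy_adjoint_difference hP hA₀ hA (hτ k) hadj₀ (hψ k) (hadj k) hT₀ hT₁
    hκ₀ hκ₁
  have hn : ∀ ℓ : StrongDual ℝ (H10 Ω),
      Tendsto (fun k => ℓ ((1 / 2 : ℝ) • (y k - y₀))) atTop (𝓝 0) := fun ℓ => by
    have := ((hy ℓ).sub_const (ℓ y₀)).const_mul (1 / 2 : ℝ)
    rw [sub_self, mul_zero] at this
    refine this.congr fun k => ?_
    rw [map_smul, map_sub, smul_eq_mul]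
  have hw : Tendsto (fun k => ψ k - ψ₀) atTop (𝓝 (ψlim - ψ₀)) := hlim.sub_const ψ₀
  have h0 := energy_limit_eq_zero (gradL Ω) (valL Ω) hw hn hτ0 hid
  have h1 := hpos (gradL Ω (ψlim - ψ₀))
  rw [real_inner_comm, h0] at h1
  have h2 : ‖gradL Ω (ψlim - ψ₀)‖ ^ 2 ≤ 0 := by
    by_contra! h
    linarith [mul_pos hP.α_pos h]
  have h3 : grad (ψlim - ψ₀) = 0 := norm_eq_zero.1 (pow_eq_zero_iff two_ne_zero |>.1
    (le_antisymm h2 (sq_nonneg _)))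
  exact sub_eq_zero.1 (eq_zero_of_grad_eq_zero hN hbdd h3)

end Optimality

/-! ### The variational inequality. -/

section Main

variable {N : ℕ} {Ω : Opens (E N)} {P : Data Ω}

/-- The difference of the symmetric parts, tested with `λ∇y₀ + ∇ψ`, in operator form. -/
lemma integral_symPart_sub_eq {A₀ A : L2Mat Ω} {T₀ T₁ : L2Vec Ω →L[ℝ] L2Vec Ω}
    (hT₀ : ∀ u : L2Vec Ω, T₀ u =ᵐ[vol Ω] fun x => app (symPart A₀) x (u x))
    (hT₁ : ∀ u : L2Vec Ω, T₁ u =ᵐ[vol Ω] fun x => app (symPart A) x (u x))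
    (lam : ℝ) (y₀ ψ : H10 Ω) :
    ∫ x in (Ω : Set (E N)),
        ⟪grad y₀ x, app (symPart A - symPart A₀) x (lam • grad y₀ x + grad ψ x)⟫ =
      lam * ⟪grad y₀, T₁ (grad y₀) - T₀ (grad y₀)⟫ +
        ⟪grad y₀, T₁ (grad ψ) - T₀ (grad ψ)⟫ := by
  set u : L2Vec Ω := lam • grad y₀ + grad ψ with hu
  have e : ∫ x in (Ω : Set (E N)),
      ⟪grad y₀ x, app (symPart A - symPart A₀) x (lam • grad y₀ x + grad ψ x)⟫ =
        ⟪grad y₀, T₁ u - T₀ u⟫ := by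
    rw [L2.inner_def]
    refine integral_congr_ae ?_
    filter_upwards [hT₀ u, hT₁ u, Lp.coeFn_sub (T₁ u) (T₀ u), Lp.coeFn_add (lam • grad y₀) (grad ψ),
      Lp.coeFn_smul lam (grad y₀), app_sub_left_ae (symPart A) (symPart A₀)] with x h0 h1 h2 h3 h4 h5
    have h6 : u x = lam • grad y₀ x + grad ψ x := by
      rw [hu, h3, Pi.add_apply, h4, Pi.smul_apply]
    rw [h2, Pi.sub_apply, h0, h1, ← h6, h5]
  rw [e, hu]
  simp only [map_add, map_smul, inner_sub_right, inner_add_right, real_inner_smul_right]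
  ring

/-- The variational inequality for the limit of the quasi-adjoint states. -/
lemma variational_inequality (hP : P.Standing) (hN : 2 ≤ N)
    (hbdd : Bornology.IsBounded (Ω : Set (E N))) (hLip : HasLipschitzBoundary Ω)
    {A₀ A : L2Mat Ω} {y₀ ψ₀ : H10 Ω} {y : L2Mat Ω → ℝ → H10 Ω} {lam : ℝ} (hlam : 0 < lam)
    (h1 : P.H1) (h2 : P.H2 A₀ y₀) (h3 : P.H3 A₀ y₀ y) (h4 : P.H4 A₀ y₀ y lam)
    (hψ₀ : P.Regular ψ₀) (hadj₀ : P.IsAdjointSolution lam A₀ y₀ ψ₀) (hA : A ∈ P.Admissible) :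
    bracket A₀ y₀ ψ₀ - bracket A y₀ ψ₀ ≤
      ∫ x in (Ω : Set (E N)),
        ⟪grad y₀ x, app (symPart A - symPart A₀) x (lam • grad y₀ x + grad ψ₀ x)⟫ := by
  have hA₀ : A₀ ∈ P.Admissible := h2.1.1.1
  obtain ⟨T₀, hT₀, hs₀, hpos⟩ := exists_symOp hP hA₀
  obtain ⟨T₁, hT₁, hs₁, -⟩ := exists_symOp hP hA
  obtain ⟨ℓ₀, -, hℓ₀⟩ := exists_dual_eq_bracket (h1 A₀ hA₀ h2.2)
  obtain ⟨ℓ₁, -, hℓ₁⟩ := exists_dual_eq_bracket (h1 A hA h2.2)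
  obtain ⟨hsol, hweak, hD⟩ := h3 A hA
  -- The value `1/2` is exact for every `θ`, since the cost is quadratic in the state.
  obtain ⟨ψ, hψ, hcpt⟩ := h4 A hA (fun _ => 1 / 2) fun _ => ⟨by norm_num, by norm_num⟩
  have hθ : ∀ k : ℕ, 1 / ((k : ℝ) + 1) ∈ Set.Ioc (0 : ℝ) 1 := fun k =>
    ⟨by positivity, by rw [div_le_one (by positivity)]; linarith [k.cast_nonneg (α := ℝ)]⟩
  obtain ⟨ψlim, σ, hσ, hlim⟩ := hcpt _ hθ tendsto_one_div_add_atTop_nhds_zero_nat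
  set τ : ℕ → ℝ := fun k => 1 / ((σ k : ℝ) + 1) with hτdef
  have hτ : ∀ k, τ k ∈ Set.Ioc (0 : ℝ) 1 := fun k => hθ (σ k)
  have hτI : ∀ k, τ k ∈ Set.Icc (0 : ℝ) 1 := fun k => Set.Ioc_subset_Icc_self (hτ k)
  have hτ0 : Tendsto τ atTop (𝓝 0) :=
    tendsto_one_div_add_atTop_nhds_zero_nat.comp hσ.tendsto_atTop
  have hτw : Tendsto τ atTop (𝓝[>] 0) :=
    tendsto_nhdsWithin_iff.2 ⟨hτ0, Eventually.of_forall fun k => (hτ k).1⟩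
  have hlimeq : ψlim = ψ₀ :=
    quasiAdjoint_limit_eq hP hN hbdd hA₀ hA hτI hτ0 (fun ℓ => (hweak ℓ).comp hτw) hψ₀ hadj₀
      (fun k => (hψ _ (hτI k)).2) (fun k => (hψ _ (hτI k)).1) hlim hT₀ hT₁ hpos
  subst hlimeq
  -- With `y(A_θ)` eliminated, the inequality depends on `θ` through the adjoint state alone, and
  -- continuously so.
  let F : H10 Ω → ℝ := fun v => lam * ⟪grad y₀, T₁ (grad y₀) - T₀ (grad y₀)⟫ +
    (⟪grad y₀, T₁ (gradL Ω v) - T₀ (gradL Ω v)⟫ + ℓ₁ v - ℓ₀ v)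
  have hF : Continuous F := by fun_prop
  have h0 : 0 ≤ F ψlim := by
    refine ge_of_tendsto ((hF.tendsto ψlim).comp hlim) ?_
    filter_upwards [hτw.eventually hD] with k hk
    have := optimality_inequality hP hN hbdd hLip hlam h2.1 hA (h1 A hA h2.2) (hτ k)
      (h1 _ (segment_mem_admissible hP hA₀ hA (hτI k)) hk) (hsol _ (hτI k)) (hψ _ (hτI k)).2
      (hψ _ (hτI k)).1 hT₀ hT₁ hs₀ hs₁
    rwa [hℓ₀, hℓ₁] at this
  rw [integral_symPart_sub_eq hT₀ hT₁, hℓ₀, hℓ₁]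
  simp only [F, gradL_apply] at h0
  linarith

end Main

end SkewControl

end

open SkewControl in
theorem theorem33p24 {N : ℕ} (hN : 2 ≤ N) (Ω : Opens (E N))
    (hbdd : Bornology.IsBounded (Ω : Set (E N))) (hconn : IsConnected (Ω : Set (E N)))
    (hLip : HasLipschitzBoundary Ω) (P : Data Ω) (hP : P.Standing)
    (A₀ : L2Mat Ω) (y₀ : H10 Ω) (y : L2Mat Ω → ℝ → H10 Ω) (lam₀ : ℝ) (hlam₀ : 0 < lam₀)
    (h1 : P.H1) (h2 : P.H2 A₀ y₀) (h3 : P.H3 A₀ y₀ y) (h4 : P.H4 A₀ y₀ y lam₀) :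
    ∃ (lam : ℝ) (ψ : H10 Ω), 0 ≤ lam ∧ ¬ (lam = 0 ∧ ψ = 0) ∧
      (∀ φ : 𝓓(Ω, ℝ), ∫ x in (Ω : Set (E N)), ⟪gradient φ x, app A₀ x (grad y₀ x)⟫ =
        P.f (ofTest φ)) ∧
      (∀ φ : 𝓓(Ω, ℝ), ∫ x in (Ω : Set (E N)), ⟪gradient φ x, app A₀ᵀ x (grad ψ x)⟫ =
        -2 * lam * (∫ x in (Ω : Set (E N)), (val y₀ x - P.yd x) * φ x)
        - 2 * lam * (∫ x in (Ω : Set (E N)),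
            ⟪gradient φ x, app (symPart A₀) x (grad y₀ x)⟫)) ∧
      ∀ A ∈ P.Admissible,
        bracket A₀ y₀ ψ - bracket A y₀ ψ ≤
          ∫ x in (Ω : Set (E N)),
            ⟪grad y₀ x, app (symPart A - symPart A₀) x (lam • grad y₀ x + grad ψ x)⟫ := by
  -- For the constant segment and `ε = 0`, the quasi-adjoint state at `θ = 0` is a regular adjoint
  -- state at `(A₀, y₀)`, chosen before any competitor `A`.
  obtain ⟨ψ, hψ, -⟩ := h4 A₀ h2.1.1.1 (fun _ => 0) fun _ => ⟨le_rfl, zero_le_one⟩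
  obtain ⟨hadj, hreg⟩ := hψ 0 ⟨le_rfl, zero_le_one⟩
  have hadj₀ : P.IsAdjointSolution lam₀ A₀ y₀ (ψ 0) := by
    simpa [Data.IsQuasiAdjoint, Data.segment] using hadj
  exact ⟨lam₀, ψ 0, hlam₀.le, fun h => hlam₀.ne' h.1, h2.1.1.2.2, hadj₀, fun A hA =>
    variational_inequality hP hN hbdd hLip hlam₀ h1 h2 h3 h4 hreg hadj₀ hA⟩
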